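/- **Theorem (power method for the Helmholtz equation whose spectrum contains a zero mode).** Let $\Omega\subseteq\mathbb R^d$ be open and connected. Boundary conditions are given by a closed subspace $V\subseteq H^1(\Omega)$ containing $C_c^\infty(\Omega)$ (for instance $V=H^1(\Omega)$ for Neumann conditions, or the periodic functions in $H^1$ of a box). Let $\Sigma:\Omega\to(0,\infty)$ be measurable and bounded. A *mode* with eigenvalue $E$ is a $\Psi\in V$, $\Psi\neq0$, with $-\Delta\Psi=E\,\Sigma\,\Psi$ in the weak sense, i.e. $\int_\Omega\nabla\Psi\cdot\nabla v=E\int_\Omega\Sigma\Psi v$ for all $v\in V$; it is *normalized* if $\int_\Omega\Sigma\Psi^2=1$. The *overlap* of $\Xi\in L^2(\Omega)$ with $\Psi$ is $\int_\Omega\Xi\sqrt\Sigma\,\Psi$. Assume that the homogeneous problem ($\Sigma\equiv1$, same $V$) has discrete spectrum, i.e. $L^2(\Omega)$ has an orthonormal basis $(\phi_n)_{n\in\mathbb N}$ of its modes with eigenvalues $\epsilon_n\to\infty$, and that there is a zero mode, i.e. a mode with eigenvalue $0$. Let $G^{(0)}$ be the regularized Green's function of the homogeneous problem (the zero mode removed):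 a measurable kernel on $\Omega\times\Omega$ such that for every $f\in L^2(\Omega)$ the function $u(x)=\int_\Omega G^{(0)}(x,y)f(y)\,dy$ (absolutely convergent for a.e. $x$) is in $V$, has $\int_\Omega u=0$, and is the weak solution of $-\Delta u=f-\frac1{|\Omega|}\int_\Omega f$. Let $\Xi^{(0)}\in L^2(\Omega)$ and, for $p\ge1$, $$\tilde\Xi^{(p)}(x)=\sqrt{\Sigma(x)}\int_\Omega G^{(0)}(x,y)\sqrt{\Sigma(y)}\,\Xi^{(p-1)}(y)\,dy,\qquad \Xi^{(p)}=\tilde\Xi^{(p)}-\sqrt{\Sigma}\;\frac{\int_\Omega\sqrt{\Sigma}\,\tilde\Xi^{(p)}}{\int_\Omega\Sigma}.$$ Then $\Xi^{(p)}\in L^2(\Omega)$ for all $p$. Let $\Theta=\Xi^{(0)}$ if $\int_\Omega\sqrt\Sigma\,\Xi^{(0)}=0$; for arbitrary $\Xi^{(0)}$, let $\Theta=\Xi^{(1)}$. In both cases the following holds. 1. If $\Theta$ overlaps some mode with positive eigenvalue, then there is a least $E>0$ that is the eigenvalue of a mode overlapping $\Theta$, and the normalized iterates converge to a mode with eigenvalue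 $E$: there is a normalized mode $\Psi$ with eigenvalue $E$ such that $\Xi^{(p)}/\|\Xi^{(p)}\|_{L^2(\Omega)}\to\sqrt\Sigma\,\Psi$ in $L^2(\Omega)$, and $$\frac{\Xi^{(p)}}{\|\Xi^{(p)}\|_{L^2(\Omega)}\sqrt\Sigma}\longrightarrow\Psi\qquad(p\to\infty)$$ in $L^2(\Omega)$ and pointwise almost everywhere in $\Omega$. Moreover $\sqrt\Sigma\,\Psi$ is a positive multiple of the orthogonal projection of $\Theta$ to $\{\sqrt\Sigma\,\Psi':\Psi'\text{ is a mode with eigenvalue }E\text{, or }0\}$. 2. In particular, let $E_1$ be the smallest positive eigenvalue, suppose that it is simple, and let $\Psi_1$ be a normalized mode with eigenvalue $E_1$. If $s=\int_\Omega\Theta\sqrt\Sigma\,\Psi_1\neq0$, then $\Xi^{(p)}/(\|\Xi^{(p)}\|_{L^2(\Omega)}\sqrt\Sigma)\to\operatorname{sgn}(s)\,\Psi_1$, in the same senses. -/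

import Mathlib

open MeasureTheory Filter Topology
open scoped ContDiff InnerProductSpace ENNReal

noncomputable section

namespace Helmholtz

/-- Euclidean space `ℝ^d`. -/
abbrev Space (d : ℕ) := EuclideanSpace ℝ (Fin d)

/-- Lebesgue measure on the region `Ω`. -/
abbrev vol {d : ℕ} (Ω : Set (Space d)) : Measure (Space d) := volume.restrict Ω

/-- The real Hilbert space `L²(Ω)`. -/
abbrev L2 {d : ℕ} (Ω : Set (Space d)) := Lp ℝ 2 (vol Ω)

/-- The real Hilbert space `L²(Ω; ℝ^d)` of square integrable vector fields. -/
abbrev L2Field {d : ℕ} (Ω : Set (Space d)) := Lp (Space d) 2 (vol Ω)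

/-- `η ∈ C_c^∞(Ω)`. -/
def IsTestFunction {d : ℕ} (Ω : Set (Space d)) (η : Space d → ℝ) : Prop :=
  ContDiff ℝ ∞ η ∧ HasCompactSupport η ∧ tsupport η ⊆ Ω

/-- `g` is the weak gradient of `u` on `Ω`; so `u ∈ H¹(Ω)` and `g = ∇u`. -/
def IsWeakGradient {d : ℕ} (Ω : Set (Space d)) (u : L2 Ω) (g : L2Field Ω) : Prop :=
  ∀ η : Space d → ℝ, IsTestFunction Ω η →
    ∫ x in Ω, u x • gradient η x = - ∫ x in Ω, η x • g x

/-- Homogeneous boundary conditions for the Laplacian on `Ω`, in weak form: a closed subspace `V`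
of `H¹(Ω)` which contains `C_c^∞(Ω)`. A function `u ∈ V` is recorded as the pair `(u, ∇u)`.
All of `H¹(Ω)` gives Neumann conditions; the functions of `H¹` of a box whose traces on opposite
faces agree give periodic conditions; the closure of `C_c^∞(Ω)` gives Dirichlet conditions. -/
structure BoundaryCondition {d : ℕ} (Ω : Set (Space d)) where
  /-- the form domain, as a set of pairs `(u, ∇u)` -/
  dom : Submodule ℝ (L2 Ω × L2Field Ω)
  isClosed_dom : IsClosed (dom : Set (L2 Ω × L2Field Ω))
  isWeakGradient : ∀ w ∈ dom, IsWeakGradient Ω w.1 w.2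
  testFunction_mem : ∀ η : Space d → ℝ, IsTestFunction Ω η →
    ∃ w ∈ dom, w.1 =ᵐ[vol Ω] η ∧ w.2 =ᵐ[vol Ω] gradient η

/-- `Ψ` is a mode (eigenfunction) with eigenvalue `E` of the Helmholtz equation
`-Δ Ψ = E σ Ψ` on `Ω` with the boundary conditions `V`, in weak form. -/
def IsMode {d : ℕ} {Ω : Set (Space d)} (V : BoundaryCondition Ω) (σ : Space d → ℝ)
    (E : ℝ) (Ψ : L2 Ω) : Prop :=
  Ψ ≠ 0 ∧ ∃ g : L2Field Ω, (Ψ, g) ∈ V.dom ∧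
    ∀ w ∈ V.dom, ∫ x in Ω, ⟪g x, w.2 x⟫_ℝ = E * ∫ x in Ω, σ x * Ψ x * w.1 x

/-- The homogeneous problem `-Δ φ = ε φ` on `Ω` with the boundary conditions `V` has discrete
spectrum: `L²(Ω)` has an orthonormal basis of its modes, with eigenvalues tending to infinity. -/
def HasDiscreteSpectrum {d : ℕ} {Ω : Set (Space d)} (V : BoundaryCondition Ω) : Prop :=
  ∃ (φ : HilbertBasis ℕ ℝ (L2 Ω)) (ε : ℕ → ℝ),
    Tendsto ε atTop atTop ∧ ∀ n, IsMode V (fun _ => 1) (ε n) (φ n)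

/-- `G` is the regularized Green's function of `-Δ` on `Ω` with the boundary conditions `V`, when
the constants are the zero modes: `-Δ_x G(x, y) = δ(x - y) - 1 / |Ω|` and `∫ G(x, y) dx = 0`.
That is, for every `f ∈ L²(Ω)` the function `u(x) = ∫ G(x, y) f(y) dy` is the weak solution of zero
mean of `-Δ u = f - ⨍ f` with the boundary conditions `V`. -/
def IsRegularizedGreen {d : ℕ} {Ω : Set (Space d)} (V : BoundaryCondition Ω)
    (G : Space d → Space d → ℝ) : Prop :=
  AEStronglyMeasurable (Function.uncurry G) ((vol Ω).prod (vol Ω)) ∧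
  ∀ f : Space d → ℝ, MemLp f 2 (vol Ω) →
    (∀ᵐ x ∂(vol Ω), Integrable (fun y => G x y * f y) (vol Ω)) ∧
    ∃ u ∈ V.dom, (u.1 =ᵐ[vol Ω] fun x => ∫ y in Ω, G x y * f y) ∧
      ∫ x in Ω, u.1 x = 0 ∧
      ∀ w ∈ V.dom, ∫ x in Ω, ⟪u.2 x, w.2 x⟫_ℝ = ∫ x in Ω, (f x - ⨍ y in Ω, f y) * w.1 x

/-- `x ↦ √σ(x) ∫_Ω G(x, y) √σ(y) Ξ(y) dy`. -/
def greenStep {d : ℕ} (Ω : Set (Space d)) (σ : Space d → ℝ) (G : Space d → Space d → ℝ)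
    (Ξ : Space d → ℝ) : Space d → ℝ :=
  fun x => √(σ x) * ∫ y in Ω, G x y * (√(σ y) * Ξ y)

/-- Removal of the component along `√σ`. -/
def removeZeroMode {d : ℕ} (Ω : Set (Space d)) (σ : Space d → ℝ)
    (Θ : Space d → ℝ) : Space d → ℝ :=
  fun x => Θ x - √(σ x) * ((∫ y in Ω, √(σ y) * Θ y) / ∫ y in Ω, σ y)

/-- The sequence `Ξ^(p)` started at `Ξ₀`. -/
def iterates {d : ℕ} (Ω : Set (Space d)) (σ : Space d → ℝ) (G : Space d → Space d → ℝ)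
    (Ξ₀ : Space d → ℝ) : ℕ → Space d → ℝ
  | 0 => Ξ₀
  | p + 1 => removeZeroMode Ω σ (greenStep Ω σ G (iterates Ω σ G Ξ₀ p))

/-- The overlap `∫_Ω Ξ Φ` of `Ξ` with the mode `Ψ`, where `Φ = √σ Ψ`. -/
def overlap {d : ℕ} {Ω : Set (Space d)} (σ : Space d → ℝ) (Ξ : Space d → ℝ) (Ψ : L2 Ω) : ℝ :=
  ∫ x in Ω, Ξ x * (√(σ x) * Ψ x)

/-- The mode `Ψ` is normalized: `∫_Ω σ Ψ² = 1`, i.e. `Φ = √σ Ψ` has norm one in `L²(Ω)`. -/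
def IsNormalized {d : ℕ} {Ω : Set (Space d)} (σ : Space d → ℝ) (Ψ : L2 Ω) : Prop :=
  ∫ x in Ω, σ x * Ψ x ^ 2 = 1

/-- The eigenvalues of the positive modes which have an overlap with `Ξ`. -/
def overlappingEigenvalues {d : ℕ} {Ω : Set (Space d)} (V : BoundaryCondition Ω)
    (σ : Space d → ℝ) (Ξ : Space d → ℝ) : Set ℝ :=
  {E | 0 < E ∧ ∃ Ψ : L2 Ω, IsMode V σ E Ψ ∧ overlap σ Ξ Ψ ≠ 0}

/-- `Ψ` is the normalized lowest positive mode having an overlap with `Ξ`, and `E` is its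
eigenvalue: `E` is the least positive eigenvalue having a mode that overlaps `Ξ`, and the
orthogonal projection of `Ξ` to the eigenspace `{√σ Ψ'}` of `E` is a positive multiple of `√σ Ψ`.
The last condition selects `Ψ` if `E` is degenerate, and its sign if `E` is simple. -/
def IsLowestOverlappingMode {d : ℕ} {Ω : Set (Space d)} (V : BoundaryCondition Ω)
    (σ : Space d → ℝ) (Ξ : Space d → ℝ) (E : ℝ) (Ψ : L2 Ω) : Prop :=
  IsLeast (overlappingEigenvalues V σ Ξ) E ∧ IsMode V σ E Ψ ∧ IsNormalized σ Ψ ∧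
    ∃ c : ℝ, 0 < c ∧ ∀ Ψ' : L2 Ω, IsMode V σ E Ψ' →
      overlap σ Ξ Ψ' = c * ∫ x in Ω, σ x * Ψ x * Ψ' x

/-- The norm of `Ξ` in `L²(Ω)`. -/
def norm2 {d : ℕ} (Ω : Set (Space d)) (Ξ : Space d → ℝ) : ℝ :=
  √(∫ x in Ω, Ξ x ^ 2)

/-- The functions `Ξ^(p)`, normalized in `L²(Ω)`, converge to the mode `Ψ`: one has
`Ξ^(p) / ‖Ξ^(p)‖ → √σ Ψ` in `L²(Ω)`, and `Ξ^(p) / (‖Ξ^(p)‖ √σ) → Ψ` both in `L²(Ω)` and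
pointwise almost everywhere in `Ω`. -/
def ConvergesToMode {d : ℕ} {Ω : Set (Space d)} (σ : Space d → ℝ) (Ξ : ℕ → Space d → ℝ)
    (Ψ : L2 Ω) : Prop :=
  Tendsto (fun p => eLpNorm (fun x => Ξ p x / norm2 Ω (Ξ p) - √(σ x) * Ψ x) 2 (vol Ω))
    atTop (𝓝 0) ∧
  Tendsto (fun p => eLpNorm (fun x => Ξ p x / norm2 Ω (Ξ p) / √(σ x) - Ψ x) 2 (vol Ω))
    atTop (𝓝 0) ∧
  ∀ᵐ x ∂(vol Ω), Tendsto (fun p => Ξ p x / norm2 Ω (Ξ p) / √(σ x)) atTop (𝓝 (Ψ x))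

end Helmholtz

end

open Helmholtz

/-! Let `S` be multiplication by √σ, `T` the operator with kernel `G`, `e` the constant 1 and `P`
the projection away from `S e`. On the complement of `S e`, one step of the iteration is the
operator `A = P S T S P` (`projectedStep`). The weak equation makes `T` symmetric and positive, and
the discrete spectrum makes it compact, so `A` is symmetric, positive and compact. The eigenvectors
of `A` with eigenvalue `l > 0` are exactly the `S Ψ` with `Ψ` a mode of eigenvalue `l⁻¹`
(`isFormMode_apply`, `exists_isFormMode_of_eigenvector`). The power method therefore selects the
smallest `E` visible from `Θ`.

`exists_dominant_eigenvector` proves this without diagonalizing `A`: on the closed cyclic subspace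
of `Θ` no eigenvector is orthogonal to `Θ`, so the top eigenvalue is simple there and the rest of
the cyclic subspace contracts strictly faster. The rate is geometric.

Since σ may approach 0, dividing by √σ need not be continuous on L²(Ω). Convergence of the quotients
is instead obtained from a bounded operator (`liftedStep`) that produces each iterate already
divided by √σ. The geometric rate turns L² convergence into convergence almost everywhere. -/

namespace Helmholtz

/-! ### Power iteration for positive compact operators. -/

section PowerIteration

variable {H : Type*} [NormedAddCommGroup H] [InnerProductSpace ℝ H] {A : H →L[ℝ] H}

/-- A positive compact operator attains its norm on a closed invariant subspace at an
eigenvector. -/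
theorem exists_norm_le_and_eigenvector (hc : IsCompactOperator A)
    (hs : (A : H →ₗ[ℝ] H).IsSymmetric) (hpos : ∀ x, 0 ≤ ⟪A x, x⟫_ℝ) (K : Submodule ℝ H)
    (hK : IsClosed (K : Set H)) (hinv : ∀ x ∈ K, A x ∈ K) :
    ∃ m : ℝ, 0 ≤ m ∧ (∀ x ∈ K, ‖A x‖ ≤ m * ‖x‖) ∧
      (0 < m → ∃ Φ ∈ K, Φ ≠ 0 ∧ A Φ = m • Φ) := by
  set B : K →L[ℝ] H := A.comp K.subtypeL with hB
  have hle : ∀ x ∈ K, ‖A x‖ ≤ ‖B‖ * ‖x‖ := fun x hx => B.le_opNorm ⟨x, hx⟩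
  refine ⟨‖B‖, B.opNorm_nonneg, hle, fun hm => ?_⟩
  set m := ‖B‖ with hmdef
  have hex : ∀ n : ℕ, ∃ x : K, ‖x‖ < 1 ∧ m - 1 / ((n : ℝ) + 1) < ‖B x‖ := fun n =>
    B.exists_lt_apply_of_lt_opNorm (sub_lt_self _ Nat.one_div_pos_of_nat)
  choose x hx1 hx2 using hex
  obtain ⟨C, hC, hCsub⟩ := IsCompactOperator.image_closedBall_subset_compact (f := (A : H →ₗ[ℝ] H)) hc 1
  have hmem : ∀ n, A (x n) ∈ C := fun n => hCsub ⟨x n, by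
    simpa using (hx1 n).le, rfl⟩
  obtain ⟨y, -, φ, hφ, hy⟩ := hC.tendsto_subseq hmem
  have hnorm : Tendsto (fun n => ‖A (x n)‖) atTop (𝓝 m) := by
    refine tendsto_of_tendsto_of_tendsto_of_le_of_le (g := fun n : ℕ => m - 1 / ((n : ℝ) + 1))
      (h := fun _ => m) ?_ tendsto_const_nhds (fun n => (hx2 n).le) fun n => ?_
    · simpa using tendsto_const_nhds.sub (tendsto_one_div_add_atTop_nhds_zero_nat (𝕜 := ℝ))
    · calc ‖A (x n)‖ ≤ m * ‖(x n : H)‖ := hle _ (x n).2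
        _ ≤ m * 1 := by gcongr; exact (hx1 n).le
        _ = m := mul_one m
  have hnormφ := hnorm.comp hφ.tendsto_atTop
  -- Expanding the square shows that a norm-maximizing sequence is asymptotically an eigenvector of
  -- `A ^ 2` for `m ^ 2`. Invariance of `K` bounds the term `A (A (x n))`.
  have hsq : ∀ n, ‖A (A (x n)) - m ^ 2 • (x n : H)‖ ^ 2 ≤ m ^ 2 * (m ^ 2 - ‖A (x n)‖ ^ 2) := by
    intro n
    have h1 : ‖A (A (x n))‖ ≤ m * ‖A (x n)‖ := hle _ (hinv _ (x n).2)
    have h2 : ⟪A (A (x n)), (x n : H)⟫_ℝ = ‖A (x n)‖ ^ 2 := by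
      rw [← real_inner_self_eq_norm_sq]; exact hs _ _
    have h3 : ‖(x n : H)‖ ^ 2 ≤ 1 := pow_le_one₀ (norm_nonneg _) (hx1 n).le
    have h4 : ‖A (A (x n))‖ ^ 2 ≤ (m * ‖A (x n)‖) ^ 2 := by gcongr
    rw [norm_sub_sq_real, inner_smul_right, h2, norm_smul, mul_pow, Real.norm_eq_abs, sq_abs]
    nlinarith [mul_le_mul_of_nonneg_left h3 (sq_nonneg (m ^ 2))]
  have hdiff : Tendsto (fun n => A (A (x (φ n))) - m ^ 2 • (x (φ n) : H)) atTop (𝓝 0) := by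
    rw [tendsto_zero_iff_norm_tendsto_zero]
    have h0 : Tendsto (fun n => ‖A (A (x (φ n))) - m ^ 2 • (x (φ n) : H)‖ ^ 2) atTop (𝓝 0) := by
      refine squeeze_zero (fun n => sq_nonneg _) (fun n => hsq (φ n)) ?_
      have h := (tendsto_const_nhds (x := m ^ 2)).mul
        ((tendsto_const_nhds (x := m ^ 2)).sub (hnormφ.pow 2))
      rwa [sub_self, mul_zero] at h
    simpa using h0.sqrt
  -- Compactness only makes `A (x n)` converge; as `m ^ 2 • x n` is asymptotic to `A (A (x n))`, the
  -- vectors `x n` converge too.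
  have hxlim : Tendsto (fun n => (x (φ n) : H)) atTop (𝓝 ((m ^ 2)⁻¹ • A y)) := by
    have h := ((A.continuous.tendsto y).comp hy).sub hdiff
    have h' := h.const_smul (m ^ 2)⁻¹
    simpa [smul_smul, hm.ne'] using h'
  set z := (m ^ 2)⁻¹ • A y with hz
  have hAz : A z = y := tendsto_nhds_unique ((A.continuous.tendsto z).comp hxlim) hy
  have hzK : z ∈ K := hK.mem_of_tendsto hxlim (Eventually.of_forall fun n => (x (φ n)).2)
  have hAz' : ‖A z‖ = m :=
    tendsto_nhds_unique ((A.continuous.tendsto z).norm.comp hxlim) hnormφ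
  have hz0 : z ≠ 0 := by
    rintro h; rw [h, map_zero, norm_zero] at hAz'; exact hm.ne hAz'
  have hAAz : A (A z) = m ^ 2 • z := by
    rw [hAz, hz, smul_smul, mul_inv_cancel₀ (pow_ne_zero 2 hm.ne'), one_smul]
  clear_value z
  -- From `(A - m) (A + m) z = 0`, the vector `(A + m) z` is an eigenvector for `m`; positivity of
  -- `A` keeps it from vanishing.
  refine ⟨A z + m • z, K.add_mem (hinv _ hzK) (K.smul_mem _ hzK), fun h => ?_, ?_⟩
  · have h1 : ⟪A z + m • z, z⟫_ℝ = 0 := by rw [h, inner_zero_left]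
    rw [inner_add_left, real_inner_smul_left, real_inner_self_eq_norm_sq] at h1
    have := hpos z
    have : 0 < m * ‖z‖ ^ 2 := by positivity
    linarith
  · rw [map_add, map_smul A m z, hAAz, smul_add, smul_smul, add_comm, sq]

theorem norm_pow_apply_le {K : Submodule ℝ H} (hinv : ∀ x ∈ K, A x ∈ K) {m : ℝ} (hm : 0 ≤ m)
    (hle : ∀ x ∈ K, ‖A x‖ ≤ m * ‖x‖) {x : H} (hx : x ∈ K) (p : ℕ) :
    ‖(A ^ p) x‖ ≤ m ^ p * ‖x‖ := by
  have key : (A ^ p) x ∈ K ∧ ‖(A ^ p) x‖ ≤ m ^ p * ‖x‖ := by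
    induction p with
    | zero => simpa using hx
    | succ p ih =>
      rw [pow_succ', mul_apply_eq_comp]
      refine ⟨hinv _ ih.1, (hle _ ih.1).trans ?_⟩
      calc m * ‖(A ^ p) x‖ ≤ m * (m ^ p * ‖x‖) := by gcongr; exact ih.2
        _ = m ^ (p + 1) * ‖x‖ := by ring
  exact key.2

theorem pow_apply_eigenvector {l : ℝ} {Φ : H} (h : A Φ = l • Φ) (p : ℕ) :
    (A ^ p) Φ = l ^ p • Φ := by
  induction p with
  | zero => simp
  | succ p ih =>
    rw [pow_succ', mul_apply_eq_comp, ih, map_smul, h, smul_smul, pow_succ]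

/-- Power iteration for a positive compact operator: the iterates of `Θ` follow an eigenvector,
up to a geometrically smaller error. -/
theorem exists_dominant_eigenvector (hc : IsCompactOperator A)
    (hs : (A : H →ₗ[ℝ] H).IsSymmetric) (hpos : ∀ x, 0 ≤ ⟪A x, x⟫_ℝ) {Θ : H} (hΘ : A Θ ≠ 0) :
    ∃ l : ℝ, 0 < l ∧ ∃ Φ : H, Φ ≠ 0 ∧ A Φ = l • Φ ∧ ∃ m : ℝ, 0 ≤ m ∧ m < l ∧
      ∃ C : ℝ, ∀ p : ℕ, ‖(A ^ p) Θ - l ^ p • Φ‖ ≤ m ^ p * C := by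
  set K : Submodule ℝ H :=
    (Submodule.span ℝ (Set.range fun p : ℕ => (A ^ p) Θ)).topologicalClosure with hKdef
  have hKcl : IsClosed (K : Set H) := Submodule.isClosed_topologicalClosure _
  have hmemK : ∀ p : ℕ, (A ^ p) Θ ∈ K := fun p =>
    Submodule.le_topologicalClosure _ (Submodule.subset_span ⟨p, rfl⟩)
  have hΘK : Θ ∈ K := by simpa using hmemK 0
  have hmin : ∀ L : Submodule ℝ H, IsClosed (L : Set H) → (∀ p : ℕ, (A ^ p) Θ ∈ L) → K ≤ L := by
    intro L hL h
    refine Submodule.topologicalClosure_minimal _ (Submodule.span_le.2 ?_) hL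
    rintro _ ⟨p, rfl⟩
    exact h p
  have hinv : ∀ x ∈ K, A x ∈ K := by
    refine hmin (K.comap (A : H →ₗ[ℝ] H)) (hKcl.preimage A.continuous) fun p => ?_
    have := hmemK (p + 1)
    rwa [pow_succ'] at this
  -- An eigenvector orthogonal to `Θ` is orthogonal to every `(A ^ p) Θ`, hence to all of `K`,
  -- itself included.
  have hcyc : ∀ {l : ℝ} {Φ : H}, Φ ∈ K → A Φ = l • Φ → ⟪Φ, Θ⟫_ℝ = 0 → Φ = 0 := by
    intro l Φ hΦ hA h0
    have hsub : K ≤ (ℝ ∙ Φ)ᗮ := by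
      refine hmin _ (Submodule.isClosed_orthogonal _) fun p => ?_
      rw [Submodule.mem_orthogonal_singleton_iff_inner_right]
      have hsp : ⟪Φ, (A ^ p) Θ⟫_ℝ = ⟪(A ^ p) Φ, Θ⟫_ℝ := by
        have := hs.pow p Φ Θ
        rw [← ContinuousLinearMap.toLinearMap_pow] at this
        exact this.symm
      rw [hsp, pow_apply_eigenvector hA, real_inner_smul_left, h0, mul_zero]
    have := hsub hΦ
    rw [Submodule.mem_orthogonal_singleton_iff_inner_right] at this
    exact inner_self_eq_zero.1 this
  obtain ⟨l, hl, hlle, hlex⟩ := exists_norm_le_and_eigenvector hc hs hpos K hKcl hinv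
  have hlpos : 0 < l := by
    refine hl.lt_of_ne fun h => hΘ ?_
    have := hlle Θ hΘK
    rw [← h, zero_mul] at this
    exact norm_le_zero_iff.1 this
  obtain ⟨Φ, hΦK, hΦ0, hΦ⟩ := hlex hlpos
  have hinner : ⟪Φ, Θ⟫_ℝ ≠ 0 := fun h => hΦ0 (hcyc hΦK hΦ h)
  have hΦΦ : ⟪Φ, Φ⟫_ℝ ≠ 0 := fun h => hΦ0 (inner_self_eq_zero.1 h)
  set W : Submodule ℝ H := K ⊓ (ℝ ∙ Φ)ᗮ with hWdef
  have hWcl : IsClosed (W : Set H) := hKcl.inter (Submodule.isClosed_orthogonal _)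
  have hWinv : ∀ x ∈ W, A x ∈ W := by
    intro x hx
    refine ⟨hinv x hx.1, ?_⟩
    have h2 := hx.2
    rw [SetLike.mem_coe, Submodule.mem_orthogonal_singleton_iff_inner_right] at h2 ⊢
    have : ⟪A Φ, x⟫_ℝ = ⟪Φ, A x⟫_ℝ := hs Φ x
    rw [← this, hΦ, real_inner_smul_left, h2, mul_zero]
  obtain ⟨m, hm, hmle, hmex⟩ := exists_norm_le_and_eigenvector hc hs hpos W hWcl hWinv
  have hml : m < l := by
    rcases hm.eq_or_lt with h | h
    · rwa [← h]
    obtain ⟨χ, hχW, hχ0, hχ⟩ := hmex h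
    have hle : m ≤ l := by
      have := hlle χ hχW.1
      rw [hχ, norm_smul, Real.norm_of_nonneg hm] at this
      exact le_of_mul_le_mul_right this (norm_pos_iff.2 hχ0)
    -- If `m = l`, some combination of `χ` and `Φ` is an eigenvector orthogonal to `Θ`, hence zero;
    -- then `χ` is a multiple of `Φ` and orthogonal to it.
    refine hle.lt_of_ne fun heq => hχ0 ?_
    have hort : ⟪Φ, χ⟫_ℝ = 0 := Submodule.mem_orthogonal_singleton_iff_inner_right.1 hχW.2
    have hcomb : χ - (⟪χ, Θ⟫_ℝ / ⟪Φ, Θ⟫_ℝ) • Φ = 0 := by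
      refine hcyc (l := l) (K.sub_mem hχW.1 (K.smul_mem _ hΦK)) ?_ ?_
      · rw [map_sub, map_smul, hχ, hΦ, heq, smul_sub, smul_comm]
      · rw [inner_sub_left, real_inner_smul_left, div_mul_cancel₀ _ hinner, sub_self]
    have h3 : ⟪χ, χ⟫_ℝ = 0 := by
      rw [sub_eq_zero] at hcomb
      conv_lhs => arg 2; rw [hcomb]
      rw [real_inner_smul_left, hort, mul_zero]
    exact inner_self_eq_zero.1 h3
  -- `a • Φ` is the component of `Θ` along `Φ`; the remainder lies in `W`, where `A` has norm at
  -- most `m`.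
  set a := ⟪Φ, Θ⟫_ℝ / ⟪Φ, Φ⟫_ℝ with ha
  have ha0 : a ≠ 0 := div_ne_zero hinner hΦΦ
  have haΦ : A (a • Φ) = l • a • Φ := by rw [map_smul, hΦ, smul_comm]
  have hrW : Θ - a • Φ ∈ W := by
    refine ⟨K.sub_mem hΘK (K.smul_mem _ hΦK), ?_⟩
    rw [SetLike.mem_coe, Submodule.mem_orthogonal_singleton_iff_inner_right, inner_sub_right,
      real_inner_smul_right, ha, div_mul_cancel₀ _ hΦΦ, sub_self]
  refine ⟨l, hlpos, a • Φ, smul_ne_zero ha0 hΦ0, haΦ, m, hm, hml, ‖Θ - a • Φ‖, fun p => ?_⟩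
  rw [← pow_apply_eigenvector haΦ p, ← map_sub]
  exact norm_pow_apply_le hWinv hm hmle hrW p

end PowerIteration

end Helmholtz

namespace Helmholtz

/-! ### Compactness of diagonal operators. -/

section Compact

variable {H : Type*} [NormedAddCommGroup H] [InnerProductSpace ℝ H] [CompleteSpace H]

/-- A symmetric operator which is diagonal in a Hilbert basis, with diagonal entries tending to
zero, is compact. -/
theorem isCompactOperator_of_hilbertBasis {T : H →L[ℝ] H}
    (hs : (T : H →ₗ[ℝ] H).IsSymmetric) (φ : HilbertBasis ℕ ℝ H) {l : ℕ → ℝ}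
    (hl : Tendsto l atTop (𝓝 0)) (hT : ∀ n, T (φ n) = l n • φ n) : IsCompactOperator T := by
  have hcoef : ∀ x n, ⟪φ n, T x⟫_ℝ = l n * ⟪φ n, x⟫_ℝ := by
    intro x n
    have h : ⟪T (φ n), x⟫_ℝ = ⟪φ n, T x⟫_ℝ := hs (φ n) x
    rw [← h, hT, real_inner_smul_left]
  -- Finite-rank truncations; by Parseval, the norm of `T - F N` is controlled by the entries `l n`
  -- with `n ≥ N`.
  let F : ℕ → H →L[ℝ] H := fun N =>
    ∑ n ∈ Finset.range N, ((innerSL ℝ (φ n)).smulRight (l n • φ n))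
  have hFapp : ∀ N x, F N x = ∑ n ∈ Finset.range N, ⟪φ n, x⟫_ℝ • l n • φ n := by
    intro N x
    simp [F]
  have hFcomp : ∀ N, IsCompactOperator (F N) := by
    intro N
    refine (compactOperator (RingHom.id ℝ) H H).sum_mem (fun n _ => ?_)
    have h1 : IsCompactOperator (innerSL ℝ (φ n)) :=
      isCompactOperator_of_locallyCompactSpace_dom (innerSL ℝ (φ n))
    exact h1.clm_comp ((ContinuousLinearMap.id ℝ ℝ).smulRight (l n • φ n))
  have hFcoef : ∀ N x n, ⟪φ n, (T - F N) x⟫_ℝ = if n < N then 0 else l n * ⟪φ n, x⟫_ℝ := by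
    intro N x n
    rw [sub_apply, inner_sub_right, hcoef, hFapp, inner_sum]
    have : ∀ i ∈ Finset.range N, ⟪φ n, ⟪φ i, x⟫_ℝ • l i • φ i⟫_ℝ
        = if n = i then l n * ⟪φ n, x⟫_ℝ else 0 := by
      intro i _
      rw [real_inner_smul_right, real_inner_smul_right, orthonormal_iff_ite.1 φ.orthonormal]
      split_ifs with h
      · rw [h]; ring
      · ring
    rw [Finset.sum_congr rfl this, Finset.sum_ite_eq]
    simp only [Finset.mem_range]
    split_ifs <;> ring
  refine isCompactOperator_of_tendsto (l := atTop) (F := F) ?_ (Eventually.of_forall hFcomp)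
  rw [Metric.tendsto_atTop]
  intro δ hδ
  obtain ⟨N, hN⟩ := Metric.tendsto_atTop.1 hl (δ / 2) (half_pos hδ)
  refine ⟨N, fun M hM => ?_⟩
  rw [dist_comm, dist_eq_norm]
  refine lt_of_le_of_lt (ContinuousLinearMap.opNorm_le_bound _ (half_pos hδ).le fun x => ?_)
    (half_lt_self hδ)
  refine le_of_sq_le_sq ?_ (by positivity)
  have hS1 := φ.hasSum_inner_mul_inner ((T - F M) x) ((T - F M) x)
  have hS2 := (φ.hasSum_inner_mul_inner x x).mul_left ((δ / 2) ^ 2)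
  rw [mul_pow, ← real_inner_self_eq_norm_sq, ← real_inner_self_eq_norm_sq]
  refine hasSum_le (fun n => ?_) hS1 hS2
  rw [real_inner_comm, real_inner_comm (φ n) x, hFcoef]
  split_ifs with h
  · rw [mul_zero]; exact mul_nonneg (sq_nonneg _) (mul_self_nonneg _)
  · have h1 : |l n| ≤ δ / 2 := by
      have := hN n (hM.trans (not_lt.1 h))
      rw [Real.dist_eq, sub_zero] at this
      exact this.le
    have h2 : l n ^ 2 ≤ (δ / 2) ^ 2 := sq_le_sq' (abs_le.1 h1).1 (abs_le.1 h1).2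
    nlinarith [mul_le_mul_of_nonneg_right h2 (mul_self_nonneg ⟪φ n, x⟫_ℝ)]

end Compact

/-! ### Regularized inverses of a form and relative eigenvectors, in abstract Hilbert space terms.
-/

section Abstract

variable {H F : Type*} [NormedAddCommGroup H] [InnerProductSpace ℝ H]
  [NormedAddCommGroup F] [InnerProductSpace ℝ F]

/-- `T` is the regularized solution operator of the form `⟪g, g'⟫` on the form domain `D`, a space
of pairs `(u, g)`; the zero modes are the multiples of `e`. -/
structure IsRegularizedInverse (D : Submodule ℝ (H × F)) (e : H) (T : H →ₗ[ℝ] H) : Prop where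
  ne_zero : e ≠ 0
  zeroMode_mem : (e, (0 : F)) ∈ D
  eq_smul : ∀ v : H, (v, (0 : F)) ∈ D → ∃ c : ℝ, v = c • e
  inner_eq_zero : ∀ f, ⟪e, T f⟫_ℝ = 0
  weak : ∀ f, ∃ (h : F) (a : ℝ), (T f, h) ∈ D ∧ ∀ w ∈ D, ⟪h, w.2⟫_ℝ = ⟪f - a • e, w.1⟫_ℝ

/-- `Ψ` is an eigenvector of the form `⟪g, g'⟫` relative to the form `⟪S u, S u'⟫`. -/
def IsFormMode (D : Submodule ℝ (H × F)) (S : H →L[ℝ] H) (E : ℝ) (Ψ : H) : Prop :=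
  Ψ ≠ 0 ∧ ∃ g : F, (Ψ, g) ∈ D ∧ ∀ w ∈ D, ⟪g, w.2⟫_ℝ = E * ⟪S Ψ, S w.1⟫_ℝ

namespace IsRegularizedInverse

variable {D : Submodule ℝ (H × F)} {e : H} {T : H →ₗ[ℝ] H}

theorem weak_of_inner_eq_zero (hT : IsRegularizedInverse D e T) {f : H} (hf : ⟪e, f⟫_ℝ = 0) :
    ∃ h : F, (T f, h) ∈ D ∧ ∀ w ∈ D, ⟪h, w.2⟫_ℝ = ⟪f, w.1⟫_ℝ := by
  obtain ⟨h, a, hmem, hw⟩ := hT.weak f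
  have h0 := hw _ hT.zeroMode_mem
  rw [inner_zero_right, inner_sub_left, real_inner_comm, hf, real_inner_smul_left, zero_sub,
    eq_comm, neg_eq_zero] at h0
  have ha : a = 0 :=
    (mul_eq_zero.1 h0).resolve_right fun h => hT.ne_zero (inner_self_eq_zero.1 h)
  refine ⟨h, hmem, fun w hwD => ?_⟩
  rw [hw w hwD, ha, zero_smul, sub_zero]

/-- Uniqueness for the weak problem: the difference of two solutions has a gradient orthogonal to
itself, so it is a zero mode. -/
theorem exists_eq_add_smul (hT : IsRegularizedInverse D e T) {f v : H} {g : F}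
    (hf : ⟪e, f⟫_ℝ = 0) (hv : (v, g) ∈ D) (hg : ∀ w ∈ D, ⟪g, w.2⟫_ℝ = ⟪f, w.1⟫_ℝ) :
    ∃ c : ℝ, v = T f + c • e := by
  obtain ⟨h, hmem, hw⟩ := hT.weak_of_inner_eq_zero hf
  have hd : (v - T f, g - h) ∈ D := D.sub_mem hv hmem
  have h0 : g - h = 0 := by
    rw [← inner_self_eq_zero (𝕜 := ℝ), inner_sub_left, hg _ hd, hw _ hd, sub_self]
  rw [h0] at hd
  obtain ⟨c, hc⟩ := hT.eq_smul _ hd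
  exact ⟨c, by rw [← hc]; abel⟩

/-- As `T f` and `T g` are orthogonal to `e`, the constants `a` drop out and both pairings become
the energy product of the two gradients. Symmetry of `T` follows, and the last clause gives
positivity. -/
theorem exists_inner_eq (hT : IsRegularizedInverse D e T) (f g : H) :
    ∃ h k : F, ⟪f, T g⟫_ℝ = ⟪h, k⟫_ℝ ∧ ⟪g, T f⟫_ℝ = ⟪k, h⟫_ℝ ∧ (f = g → h = k) := by
  have aux : ∀ f g : H, ∀ (h k : F) (a : ℝ), (T g, k) ∈ D →
      (∀ w ∈ D, ⟪h, w.2⟫_ℝ = ⟪f - a • e, w.1⟫_ℝ) → ⟪f, T g⟫_ℝ = ⟪h, k⟫_ℝ := by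
    intro f g h k a hk hh
    rw [hh _ hk, inner_sub_left, real_inner_smul_left, hT.inner_eq_zero, mul_zero, sub_zero]
  choose h a hmem hw using hT.weak
  exact ⟨h f, h g, aux f g _ _ _ (hmem g) (hw f), aux g f _ _ _ (hmem f) (hw g),
    fun hfg => by rw [hfg]⟩

theorem isSymmetric (hT : IsRegularizedInverse D e T) : T.IsSymmetric := by
  intro f g
  obtain ⟨h, k, h1, h2, -⟩ := hT.exists_inner_eq f g
  rw [real_inner_comm, h1, h2, real_inner_comm]

theorem inner_nonneg (hT : IsRegularizedInverse D e T) (f : H) : 0 ≤ ⟪T f, f⟫_ℝ := by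
  obtain ⟨h, k, h1, -, h3⟩ := hT.exists_inner_eq f f
  rw [real_inner_comm, h1, h3 rfl]
  exact real_inner_self_nonneg

theorem apply_of_isFormMode_id (hT : IsRegularizedInverse D e T) {E : ℝ} {φ : H}
    (hφ : IsFormMode D (ContinuousLinearMap.id ℝ H) E φ) : T φ = E⁻¹ • φ := by
  obtain ⟨-, g, hg, hw⟩ := hφ
  simp only [ContinuousLinearMap.id_apply] at hw
  -- For `E = 0` the convention `0⁻¹ = 0` gives the correct value, because `T` annihilates the zero
  -- mode.
  rcases eq_or_ne E 0 with rfl | hE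
  · have h0 : g = 0 := by
      rw [← inner_self_eq_zero (𝕜 := ℝ), hw _ hg, zero_mul]
    rw [h0] at hg
    obtain ⟨c, rfl⟩ := hT.eq_smul _ hg
    have h1 : T e = 0 := by
      obtain ⟨h, a, hmem, hh⟩ := hT.weak e
      have ha := hh _ hT.zeroMode_mem
      rw [inner_zero_right, inner_sub_left, real_inner_smul_left] at ha
      have hee : ⟪e, e⟫_ℝ ≠ 0 := fun h => hT.ne_zero (inner_self_eq_zero.1 h)
      have ha1 : a = 1 := by
        have : (1 - a) * ⟪e, e⟫_ℝ = 0 := by linarith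
        linarith [(mul_eq_zero.1 this).resolve_right hee]
      have hh0 : h = 0 := by
        rw [← inner_self_eq_zero (𝕜 := ℝ), hh _ hmem, ha1, one_smul, sub_self, inner_zero_left]
      rw [hh0] at hmem
      obtain ⟨c', hc'⟩ := hT.eq_smul _ hmem
      have h2 := hT.inner_eq_zero e
      rw [hc', real_inner_smul_right] at h2
      rw [hc', (mul_eq_zero.1 h2).resolve_right hee, zero_smul]
    rw [map_smul, h1, smul_zero, inv_zero, zero_smul]
  · have hmean : ⟪e, φ⟫_ℝ = 0 := by
      have := hw _ hT.zeroMode_mem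
      rw [inner_zero_right, eq_comm, mul_eq_zero] at this
      rw [real_inner_comm]
      exact this.resolve_left hE
    obtain ⟨c, hc⟩ := hT.exists_eq_add_smul (f := E • φ) (v := φ) (g := g)
      (by rw [real_inner_smul_right, hmean, mul_zero]) hg
      (fun w hwD => by rw [hw w hwD, real_inner_smul_left])
    have hc0 : c = 0 := by
      have h1 := hmean
      rw [hc, inner_add_right, hT.inner_eq_zero, real_inner_smul_right, zero_add] at h1
      exact (mul_eq_zero.1 h1).resolve_right fun h => hT.ne_zero (inner_self_eq_zero.1 h)
    rw [hc0, zero_smul, add_zero, map_smul] at hc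
    rw [eq_comm, inv_smul_eq_iff₀ hE]
    exact hc

end IsRegularizedInverse

/-- The map `x ↦ T S x - c e`, with `c` such that the image of the result under `S` is orthogonal
to `S e`. -/
noncomputable def liftedStep (S T : H →L[ℝ] H) (e : H) : H →L[ℝ] H :=
  T.comp S - ((innerSL ℝ (S e)).comp (S.comp (T.comp S))).smulRight ((⟪S e, S e⟫_ℝ)⁻¹ • e)

theorem liftedStep_apply (S T : H →L[ℝ] H) (e x : H) :
    liftedStep S T e x = T (S x) - (⟪S e, S (T (S x))⟫_ℝ / ⟪S e, S e⟫_ℝ) • e := by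
  simp [liftedStep, smul_smul, div_eq_mul_inv]

/-- The orthogonal projection along `v`. -/
noncomputable def projAway (v : H) : H →L[ℝ] H :=
  ContinuousLinearMap.id ℝ H - (innerSL ℝ v).smulRight ((⟪v, v⟫_ℝ)⁻¹ • v)

theorem projAway_apply (v x : H) : projAway v x = x - (⟪v, x⟫_ℝ / ⟪v, v⟫_ℝ) • v := by
  simp [projAway, smul_smul, div_eq_mul_inv]

theorem inner_projAway_left (v x y : H) : ⟪projAway v x, y⟫_ℝ = ⟪x, projAway v y⟫_ℝ := by
  rw [projAway_apply, projAway_apply, inner_sub_left, inner_sub_right, real_inner_smul_left,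
    real_inner_smul_right, real_inner_comm x v]
  ring

theorem inner_projAway {v : H} (hv : v ≠ 0) (x : H) : ⟪v, projAway v x⟫_ℝ = 0 := by
  rw [projAway_apply, inner_sub_right, real_inner_smul_right,
    div_mul_cancel₀ _ fun h => hv (inner_self_eq_zero.1 h), sub_self]

theorem projAway_of_inner_eq_zero {v x : H} (h : ⟪v, x⟫_ℝ = 0) : projAway v x = x := by
  rw [projAway_apply, h, zero_div, zero_smul, sub_zero]

/-- This identifies `liftedStep` as a step of the iteration divided by √σ, realized by a bounded
operator. -/
theorem apply_liftedStep (S T : H →L[ℝ] H) (e x : H) :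
    S (liftedStep S T e x) = projAway (S e) (S (T (S x))) := by
  rw [liftedStep_apply, projAway_apply, map_sub, map_smul]

/-- The step of the power method, restricted to the orthogonal complement of `S e`. -/
noncomputable def projectedStep (S T : H →L[ℝ] H) (e : H) : H →L[ℝ] H :=
  (projAway (S e)).comp (S.comp (T.comp (S.comp (projAway (S e)))))

theorem projectedStep_apply (S T : H →L[ℝ] H) (e x : H) :
    projectedStep S T e x = S (liftedStep S T e (projAway (S e) x)) := by
  rw [apply_liftedStep]; rfl

theorem inner_projectedStep {S T : H →L[ℝ] H} {e : H} (he : S e ≠ 0) (x : H) :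
    ⟪S e, projectedStep S T e x⟫_ℝ = 0 := inner_projAway he _

/-- The inner projection in `projectedStep` serves only to make it symmetric; it acts trivially on
the complement of `S e`, where the iterates live. -/
theorem projectedStep_of_inner_eq_zero {S T : H →L[ℝ] H} {e x : H} (h : ⟪S e, x⟫_ℝ = 0) :
    projectedStep S T e x = S (liftedStep S T e x) := by
  rw [projectedStep_apply, projAway_of_inner_eq_zero h]

theorem inner_projectedStep_pow {S T : H →L[ℝ] H} {e : H} (he : S e ≠ 0) {x : H}
    (hx : ⟪S e, x⟫_ℝ = 0) (p : ℕ) : ⟪S e, (projectedStep S T e ^ p) x⟫_ℝ = 0 := by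
  cases p with
  | zero => simpa using hx
  | succ p =>
    rw [pow_succ', mul_apply_eq_comp]
    exact inner_projectedStep he _

/-! ### Eigenvectors of the step, and the abstract power method. -/

section Step

variable {D : Submodule ℝ (H × F)} {e : H} {S T : H →L[ℝ] H}

theorem inner_projectedStep_left (hS : (S : H →ₗ[ℝ] H).IsSymmetric) (x y : H) :
    ⟪projectedStep S T e x, y⟫_ℝ = ⟪T (S (projAway (S e) x)), S (projAway (S e) y)⟫_ℝ := by
  have h1 : ∀ a b, ⟪S a, b⟫_ℝ = ⟪a, S b⟫_ℝ := hS
  change ⟪projAway (S e) (S (T (S (projAway (S e) x)))), y⟫_ℝ = _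
  rw [inner_projAway_left, h1]

theorem isSymmetric_projectedStep (hT : (T : H →ₗ[ℝ] H).IsSymmetric)
    (hS : (S : H →ₗ[ℝ] H).IsSymmetric) :
    (projectedStep S T e : H →ₗ[ℝ] H).IsSymmetric := by
  intro x y
  have h2 : ∀ a b, ⟪T a, b⟫_ℝ = ⟪a, T b⟫_ℝ := hT
  change ⟪projectedStep S T e x, y⟫_ℝ = ⟪x, projectedStep S T e y⟫_ℝ
  rw [inner_projectedStep_left hS, real_inner_comm _ x, inner_projectedStep_left hS, h2,
    real_inner_comm]

/-- Testing the mode equation with the zero mode gives the orthogonality. Then `Ψ` solves the weak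
problem with source `E • S (S Ψ)`, so it equals `T` of that source up to a multiple of `e`, which
the projection removes. -/
theorem isFormMode_apply (hT : IsRegularizedInverse D e (T : H →ₗ[ℝ] H))
    (hS : (S : H →ₗ[ℝ] H).IsSymmetric) (hSinj : Function.Injective S)
    {E : ℝ} (hE : E ≠ 0) {Ψ : H} (hΨ : IsFormMode D S E Ψ) :
    ⟪S e, S Ψ⟫_ℝ = 0 ∧ liftedStep S T e (S Ψ) = E⁻¹ • Ψ := by
  obtain ⟨-, g, hg, hw⟩ := hΨ
  have h1 : ∀ a b, ⟪S a, b⟫_ℝ = ⟪a, S b⟫_ℝ := hS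
  have hort : ⟪S e, S Ψ⟫_ℝ = 0 := by
    have := hw _ hT.zeroMode_mem
    rw [inner_zero_right, eq_comm, mul_eq_zero] at this
    rw [real_inner_comm]
    exact this.resolve_left hE
  refine ⟨hort, hSinj ?_⟩
  obtain ⟨c, hc⟩ := hT.exists_eq_add_smul (f := S (S (E • Ψ))) (v := Ψ) (g := g)
    (by rw [← h1, map_smul, real_inner_smul_right, hort, mul_zero]) hg
    (fun w hwD => by rw [hw w hwD, map_smul, map_smul, real_inner_smul_left, h1 (S Ψ)])
  have hc' : T (S (S Ψ)) = E⁻¹ • (Ψ - c • e) := by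
    rw [eq_inv_smul_iff₀ hE, eq_sub_iff_add_eq, ← map_smul, ← map_smul, ← map_smul]
    exact hc.symm
  rw [apply_liftedStep, hc', map_smul, map_sub, map_smul S c, map_smul, map_sub, map_smul,
    projAway_of_inner_eq_zero hort, map_smul]
  have : projAway (S e) (S e) = 0 := by
    rcases eq_or_ne (S e) 0 with h | h
    · rw [h, map_zero]
    · rw [projAway_apply, div_self fun h' => h (inner_self_eq_zero.1 h'), one_smul, sub_self]
  rw [this, smul_zero, sub_zero]

/-- For `l ≠ 0`, `Φ` lies in the range of the projection, so the source `S Φ` is orthogonal to `e`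
and `T (S Φ)` solves the unmodified weak equation. The multiple of `e` in `liftedStep` has zero
gradient and does not disturb it. -/
theorem exists_isFormMode_of_eigenvector (hT : IsRegularizedInverse D e (T : H →ₗ[ℝ] H))
    (hS : (S : H →ₗ[ℝ] H).IsSymmetric) (he : S e ≠ 0) {l : ℝ} (hl : l ≠ 0) {Φ : H} (hΦ0 : Φ ≠ 0)
    (hΦ : projectedStep S T e Φ = l • Φ) : ∃ Ψ, S Ψ = Φ ∧ IsFormMode D S l⁻¹ Ψ := by
  have h1 : ∀ a b, ⟪S a, b⟫_ℝ = ⟪a, S b⟫_ℝ := hS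
  have hort : ⟪S e, Φ⟫_ℝ = 0 := by
    have := inner_projectedStep (T := T) he Φ
    rw [hΦ, real_inner_smul_right] at this
    exact (mul_eq_zero.1 this).resolve_left hl
  rw [projectedStep_of_inner_eq_zero hort] at hΦ
  have hSΨ : S (l⁻¹ • liftedStep S T e Φ) = Φ := by
    rw [map_smul, hΦ, inv_smul_smul₀ hl]
  refine ⟨l⁻¹ • liftedStep S T e Φ, hSΨ, fun h => hΦ0 ?_, ?_⟩
  · rw [← hSΨ, h, map_zero]
  obtain ⟨h, hmem, hw⟩ := hT.weak_of_inner_eq_zero (f := S Φ) (by rw [← h1, hort])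
  refine ⟨l⁻¹ • h, ?_, fun w hwD => ?_⟩
  · have := D.smul_mem l⁻¹ (D.sub_mem hmem (D.smul_mem
      (⟪S e, S (T (S Φ))⟫_ℝ / ⟪S e, S e⟫_ℝ) hT.zeroMode_mem))
    rw [liftedStep_apply]
    simpa using this
  · rw [real_inner_smul_left, hw w hwD, hSΨ, h1]

/-- The power method for the form `⟪g, g'⟫` relative to `⟪S u, S u'⟫`. -/
theorem exists_lowest_formMode (hT : IsRegularizedInverse D e (T : H →ₗ[ℝ] H))
    (hTc : IsCompactOperator T) (hS : (S : H →ₗ[ℝ] H).IsSymmetric)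
    (hSinj : Function.Injective S) {Θ : H}
    (hov : ∃ (E : ℝ) (Ψ : H), 0 < E ∧ IsFormMode D S E Ψ ∧ ⟪Θ, S Ψ⟫_ℝ ≠ 0) :
    ∃ (E : ℝ) (Ψ : H) (c : ℝ), 0 < E ∧ 0 < c ∧ IsFormMode D S E Ψ ∧ ⟪S Ψ, S Ψ⟫_ℝ = 1 ∧
      (∀ Ψ', IsFormMode D S E Ψ' → ⟪Θ, S Ψ'⟫_ℝ = c * ⟪S Ψ, S Ψ'⟫_ℝ) ∧
      (∀ E' Ψ', 0 < E' → IsFormMode D S E' Ψ' → ⟪Θ, S Ψ'⟫_ℝ ≠ 0 → E ≤ E') ∧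
      ∃ r C : ℝ, 0 ≤ r ∧ r < 1 ∧
        (∀ p : ℕ, ‖E ^ p • (projectedStep S T e ^ p) Θ - c • S Ψ‖ ≤ C * r ^ p) ∧
        ∀ p : ℕ, ‖E ^ (p + 1) • liftedStep S T e ((projectedStep S T e ^ p) Θ) - c • Ψ‖
          ≤ C * r ^ p := by
  have he : S e ≠ 0 := fun h => hT.ne_zero (hSinj (by rw [h, map_zero]))
  set A := projectedStep S T e with hA
  have hAs : (A : H →ₗ[ℝ] H).IsSymmetric := isSymmetric_projectedStep hT.isSymmetric hS
  have hApos : ∀ x, 0 ≤ ⟪A x, x⟫_ℝ := fun x => by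
    rw [hA, inner_projectedStep_left hS]
    exact hT.inner_nonneg _
  have hAc : IsCompactOperator A :=
    (hTc.comp_clm (S.comp (projAway (S e)))).clm_comp ((projAway (S e)).comp S)
  have hmode : ∀ {E : ℝ} {Ψ : H}, 0 < E → IsFormMode D S E Ψ → A (S Ψ) = E⁻¹ • S Ψ := by
    intro E Ψ hE hΨ
    obtain ⟨h1, h2⟩ := isFormMode_apply hT hS hSinj hE.ne' hΨ
    rw [hA, projectedStep_of_inner_eq_zero h1, h2, map_smul]
  have hpow : ∀ {E : ℝ} {Ψ : H}, 0 < E → IsFormMode D S E Ψ → ∀ p : ℕ,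
      ⟪(A ^ p) Θ, S Ψ⟫_ℝ = E⁻¹ ^ p * ⟪Θ, S Ψ⟫_ℝ := by
    intro E Ψ hE hΨ p
    have h : ⟪(A ^ p) Θ, S Ψ⟫_ℝ = ⟪Θ, (A ^ p) (S Ψ)⟫_ℝ := by
      have := hAs.pow p Θ (S Ψ)
      rw [← ContinuousLinearMap.toLinearMap_pow] at this
      exact this
    rw [h, pow_apply_eigenvector (hmode hE hΨ), real_inner_smul_right]
  have hAΘ : A Θ ≠ 0 := by
    obtain ⟨E, Ψ, hE, hΨ, h⟩ := hov
    intro h0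
    have := hpow hE hΨ 1
    rw [pow_one, pow_one, h0, inner_zero_left, eq_comm] at this
    exact (mul_ne_zero (inv_ne_zero hE.ne') h) this
  obtain ⟨l, hl, Φ, hΦ0, hΦ, m, hm, hml, C, hC⟩ := exists_dominant_eigenvector hAc hAs hApos hAΘ
  obtain ⟨Ψ', hSΨ', hΨ'⟩ := exists_isFormMode_of_eigenvector hT hS he hl.ne' hΦ0 hΦ
  have hc : 0 < ‖Φ‖ := norm_pos_iff.2 hΦ0
  set Ψ := ‖Φ‖⁻¹ • Ψ' with hΨdef
  have hΨΦ : S Ψ = ‖Φ‖⁻¹ • Φ := by rw [hΨdef, map_smul, hSΨ']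
  have hcΨ : ‖Φ‖ • S Ψ = Φ := by rw [hΨΦ, smul_inv_smul₀ hc.ne']
  have hΨ : IsFormMode D S l⁻¹ Ψ := by
    obtain ⟨h0, g, hg, hw⟩ := hΨ'
    refine ⟨smul_ne_zero (inv_ne_zero hc.ne') h0, ‖Φ‖⁻¹ • g, D.smul_mem _ hg, fun w hwD => ?_⟩
    rw [real_inner_smul_left, hw w hwD, hΨdef, map_smul, real_inner_smul_left]
    ring
  have hl' : 0 < l⁻¹ := inv_pos.2 hl
  have hr : m / l < 1 := (div_lt_one hl).2 hml
  have hr0 : 0 ≤ m / l := by positivity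
  have hgeom : ∀ p : ℕ, ‖l⁻¹ ^ p • (A ^ p) Θ - Φ‖ ≤ C * (m / l) ^ p := by
    intro p
    have h1 : l⁻¹ ^ p • (A ^ p) Θ - Φ = l⁻¹ ^ p • ((A ^ p) Θ - l ^ p • Φ) := by
      rw [smul_sub, smul_smul, ← mul_pow, inv_mul_cancel₀ hl.ne', one_pow, one_smul]
    rw [h1, norm_smul, Real.norm_of_nonneg (by positivity)]
    calc l⁻¹ ^ p * ‖(A ^ p) Θ - l ^ p • Φ‖ ≤ l⁻¹ ^ p * (m ^ p * C) := by gcongr; exact hC p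
      _ = C * (m / l) ^ p := by rw [div_pow, inv_pow]; ring
  have hlim : Tendsto (fun p : ℕ => l⁻¹ ^ p • (A ^ p) Θ) atTop (𝓝 Φ) := by
    rw [tendsto_iff_norm_sub_tendsto_zero]
    refine squeeze_zero (fun _ => norm_nonneg _) hgeom ?_
    simpa using (tendsto_pow_atTop_nhds_zero_of_lt_one hr0 hr).const_mul C
  have hC0 : 0 ≤ C := by
    have := (norm_nonneg _).trans (hgeom 0)
    simpa using this
  have hlift : liftedStep S T e (‖Φ‖ • S Ψ) = l • ‖Φ‖ • Ψ := by
    rw [map_smul, (isFormMode_apply hT hS hSinj hl'.ne' hΨ).2, inv_inv, smul_comm]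
  refine ⟨l⁻¹, Ψ, ‖Φ‖, hl', hc, hΨ, ?_, ?_, ?_, m / l, max C (l⁻¹ * ‖liftedStep S T e‖ * C),
    hr0, hr, fun p => ?_, fun p => ?_⟩
  · rw [hΨΦ, real_inner_smul_left, real_inner_smul_right, real_inner_self_eq_norm_sq]
    field_simp
  · intro χ hχ
    rw [← real_inner_smul_left, hcΨ]
    -- The pairing of the rescaled iterates with a mode of the same eigenvalue is independent of
    -- `p`, so its limit equals its value at `Θ`.
    refine tendsto_nhds_unique (f := fun p : ℕ => ⟪l⁻¹ ^ p • (A ^ p) Θ, S χ⟫_ℝ) (l := atTop) ?_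
      (hlim.inner tendsto_const_nhds)
    have : ∀ p : ℕ, ⟪l⁻¹ ^ p • (A ^ p) Θ, S χ⟫_ℝ = ⟪Θ, S χ⟫_ℝ := by
      intro p
      rw [real_inner_smul_left, hpow hl' hχ, inv_inv, ← mul_assoc, ← mul_pow,
        inv_mul_cancel₀ hl.ne', one_pow, one_mul]
    simp only [this]
    exact tendsto_const_nhds
  · intro E' χ hE' hχ hne
    -- An overlap at `E' < l⁻¹` would grow like `(l⁻¹ / E') ^ p` under the rescaling, against
    -- convergence.
    by_contra! hlt
    have h1 : ∀ p : ℕ, ⟪l⁻¹ ^ p • (A ^ p) Θ, S χ⟫_ℝ = (l⁻¹ / E') ^ p * ⟪Θ, S χ⟫_ℝ := by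
      intro p
      rw [real_inner_smul_left, hpow hE' hχ, div_eq_mul_inv, mul_pow, mul_assoc]
    have h2 : Tendsto (fun p : ℕ => (l⁻¹ / E') ^ p * ⟪Θ, S χ⟫_ℝ) atTop (𝓝 ⟪Φ, S χ⟫_ℝ) := by
      simp only [← h1]
      exact hlim.inner tendsto_const_nhds
    have h3 : Tendsto (fun p : ℕ => (l⁻¹ / E') ^ p) atTop (𝓝 (⟪Φ, S χ⟫_ℝ / ⟪Θ, S χ⟫_ℝ)) := by
      simpa [mul_div_cancel_right₀ _ hne] using h2.div_const ⟪Θ, S χ⟫_ℝ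
    exact not_tendsto_nhds_of_tendsto_atTop
      (tendsto_pow_atTop_atTop_of_one_lt ((one_lt_div hE').2 hlt)) _ h3
  · rw [hcΨ]
    exact (hgeom p).trans (by gcongr; exact le_max_left _ _)
  -- The lifted step applied to iterate `p` belongs to iterate `p + 1`, hence the extra factor
  -- `l⁻¹`.
  · have h1 : l⁻¹ ^ (p + 1) • liftedStep S T e ((A ^ p) Θ) - ‖Φ‖ • Ψ
        = l⁻¹ • liftedStep S T e (l⁻¹ ^ p • (A ^ p) Θ - ‖Φ‖ • S Ψ) := by
      rw [map_sub, hlift, smul_sub, inv_smul_smul₀ hl.ne', map_smul (liftedStep S T e) (l⁻¹ ^ p), smul_smul l⁻¹, pow_succ']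
    rw [h1, hcΨ, norm_smul, Real.norm_of_nonneg hl'.le]
    calc l⁻¹ * ‖liftedStep S T e (l⁻¹ ^ p • (A ^ p) Θ - Φ)‖
        ≤ l⁻¹ * (‖liftedStep S T e‖ * (C * (m / l) ^ p)) := by
          gcongr
          exact (ContinuousLinearMap.le_opNorm _ _).trans (by gcongr; exact hgeom p)
      _ = l⁻¹ * ‖liftedStep S T e‖ * C * (m / l) ^ p := by ring
      _ ≤ _ := by gcongr; exact le_max_right _ _

end Step

end Abstract

end Helmholtz

namespace Helmholtz

/-! ### Realization in L²(Ω). -/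

section Concrete

variable {d : ℕ} {Ω : Set (Space d)}

/-- The geometric bound makes the squared distances summable, so the sum of `|y p - y'| ^ 2` is
integrable and hence finite almost everywhere. -/
theorem ae_tendsto_of_norm_sub_le_geometric {α : Type*} [MeasurableSpace α] {μ : Measure α}
    {y : ℕ → Lp ℝ 2 μ} {y' : Lp ℝ 2 μ} {C r : ℝ} (hr0 : 0 ≤ r) (hr : r < 1)
    (h : ∀ p, ‖y p - y'‖ ≤ C * r ^ p) :
    ∀ᵐ x ∂μ, Tendsto (fun p => y p x) atTop (𝓝 (y' x)) := by
  have hint : ∀ p, ∫⁻ x, ‖(y p - y' : Lp ℝ 2 μ) x‖ₑ ^ 2 ∂μ = ENNReal.ofReal (‖y p - y'‖ ^ 2) := by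
    intro p
    have h1 := eLpNorm_nnreal_pow_eq_lintegral (μ := μ) (f := ((y p - y' : Lp ℝ 2 μ) : α → ℝ))
      (p := 2) (by norm_num)
    rw [ENNReal.ofReal_pow (norm_nonneg _), ofReal_norm, Lp.enorm_def]
    simpa using h1.symm
  have hsum : ∑' p, ∫⁻ x, ‖(y p - y' : Lp ℝ 2 μ) x‖ₑ ^ 2 ∂μ ≠ ⊤ := by
    simp_rw [hint]
    refine Summable.tsum_ofReal_ne_top ?_
    refine Summable.of_nonneg_of_le (fun p => sq_nonneg _) (fun p => ?_)
      ((summable_geometric_of_lt_one (sq_nonneg r) (by nlinarith)).mul_left (C ^ 2))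
    calc ‖y p - y'‖ ^ 2 ≤ (C * r ^ p) ^ 2 := by gcongr; exact h p
      _ = C ^ 2 * (r ^ 2) ^ p := by ring
  have hmeas : ∀ p, AEMeasurable (fun x => ‖(y p - y' : Lp ℝ 2 μ) x‖ₑ ^ 2) μ := fun p =>
    ((Lp.aestronglyMeasurable _).enorm).pow_const 2
  rw [← lintegral_tsum hmeas] at hsum
  have hae := ae_lt_top' (AEMeasurable.tsum hmeas) hsum
  have hsub : ∀ᵐ x ∂μ, ∀ p, (y p - y' : Lp ℝ 2 μ) x = y p x - y' x :=
    ae_all_iff.2 fun p => Lp.coeFn_sub (y p) y'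
  filter_upwards [hae, hsub] with x hx hs
  have h0 := ENNReal.tendsto_atTop_zero_of_tsum_ne_top hx.ne
  rw [tendsto_iff_norm_sub_tendsto_zero]
  have h1 : Tendsto (fun p => ‖y p x - y' x‖ ^ 2) atTop (𝓝 0) := by
    have h2 := (ENNReal.tendsto_toReal ENNReal.zero_ne_top).comp h0
    simpa only [hs, Function.comp_def, ENNReal.toReal_pow, toReal_enorm, ENNReal.toReal_zero]
      using h2
  simpa only [Real.sqrt_sq (norm_nonneg _), Real.sqrt_zero] using h1.sqrt

theorem inner_eq_integral (f g : L2 Ω) : ⟪f, g⟫_ℝ = ∫ x in Ω, f x * g x := by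
  rw [L2.inner_def]
  refine integral_congr_ae (Eventually.of_forall fun x => ?_)
  simp [mul_comm]

theorem norm2_eq_norm {Ξ : Space d → ℝ} {x : L2 Ω} (h : Ξ =ᵐ[vol Ω] x) : norm2 Ω Ξ = ‖x‖ := by
  rw [norm2, ← Real.sqrt_sq (norm_nonneg x), ← real_inner_self_eq_norm_sq, inner_eq_integral]
  congr 1
  refine integral_congr_ae ?_
  filter_upwards [h] with y hy
  rw [hy, sq]

/-- `S` is the multiplication by `√σ` on `L²(Ω)`. -/
def IsMulSqrt (σ : Space d → ℝ) (S : L2 Ω →L[ℝ] L2 Ω) : Prop :=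
  ∀ f : L2 Ω, S f =ᵐ[vol Ω] fun x => √(σ x) * f x

theorem memLp_sqrt_mul (hΩ : MeasurableSet Ω) {σ : Space d → ℝ} (hσm : Measurable σ)
    (hσbdd : ∃ M : ℝ, ∀ x ∈ Ω, σ x ≤ M) {f : Space d → ℝ} (hf : MemLp f 2 (vol Ω)) :
    MemLp (fun x => √(σ x) * f x) 2 (vol Ω) := by
  obtain ⟨M, hM⟩ := hσbdd
  refine hf.of_le_mul (c := √M) (hσm.sqrt.aestronglyMeasurable.mul hf.1) ?_
  filter_upwards [ae_restrict_mem hΩ] with x hx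
  rw [norm_mul, Real.norm_of_nonneg (Real.sqrt_nonneg _)]
  gcongr
  exact hM x hx

theorem exists_isMulSqrt (hΩ : MeasurableSet Ω) {σ : Space d → ℝ} (hσm : Measurable σ)
    (hσbdd : ∃ M : ℝ, ∀ x ∈ Ω, σ x ≤ M) :
    ∃ S : L2 Ω →L[ℝ] L2 Ω, IsMulSqrt σ S := by
  have hmem : ∀ f : L2 Ω, MemLp (fun x => √(σ x) * f x) 2 (vol Ω) := fun f =>
    memLp_sqrt_mul hΩ hσm hσbdd (Lp.memLp f)
  let S₀ : L2 Ω →ₗ[ℝ] L2 Ω :=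
    { toFun := fun f => (hmem f).toLp _
      map_add' := fun f g => by
        rw [← MemLp.toLp_add]
        refine MemLp.toLp_congr _ _ ?_
        filter_upwards [Lp.coeFn_add f g] with x hx
        simp only [hx, Pi.add_apply, mul_add]
      map_smul' := fun c f => by
        rw [← MemLp.toLp_const_smul]
        refine MemLp.toLp_congr _ _ ?_
        filter_upwards [Lp.coeFn_smul c f] with x hx
        simp only [hx, Pi.smul_apply, smul_eq_mul, RingHom.id_apply]
        ring }
  have hS₀ : ∀ f, S₀ f =ᵐ[vol Ω] fun x => √(σ x) * f x := fun f => MemLp.coeFn_toLp (hmem f)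
  -- Symmetry on the whole Hilbert space yields continuity (Hellinger–Toeplitz).
  have hsymm : S₀.IsSymmetric := by
    intro f g
    rw [inner_eq_integral, inner_eq_integral]
    refine integral_congr_ae ?_
    filter_upwards [hS₀ f, hS₀ g] with x h1 h2
    rw [h1, h2]; ring
  exact ⟨⟨S₀, hsymm.continuous⟩, hS₀⟩

namespace IsMulSqrt

variable {σ : Space d → ℝ} {S : L2 Ω →L[ℝ] L2 Ω}

theorem isSymmetric (hS : IsMulSqrt σ S) : (S : L2 Ω →ₗ[ℝ] L2 Ω).IsSymmetric := by
  intro f g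
  change ⟪S f, g⟫_ℝ = ⟪f, S g⟫_ℝ
  rw [inner_eq_integral, inner_eq_integral]
  refine integral_congr_ae ?_
  filter_upwards [hS f, hS g] with x h1 h2
  rw [h1, h2]; ring

theorem injective (hS : IsMulSqrt σ S) (hΩ : MeasurableSet Ω) (hσpos : ∀ x ∈ Ω, 0 < σ x) :
    Function.Injective S := by
  rw [injective_iff_map_eq_zero]
  intro f hf
  have h0 : S f =ᵐ[vol Ω] 0 := by rw [hf]; exact Lp.coeFn_zero _ _ _
  refine Lp.ext ?_
  filter_upwards [hS f, h0, Lp.coeFn_zero ℝ 2 (vol Ω), ae_restrict_mem hΩ] with x h1 h2 h3 hx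
  rw [h2, Pi.zero_apply, eq_comm, mul_eq_zero] at h1
  rw [h3, Pi.zero_apply]
  exact h1.resolve_left (Real.sqrt_pos.2 (hσpos x hx)).ne'

theorem inner_apply_apply (hS : IsMulSqrt σ S) (hΩ : MeasurableSet Ω)
    (hσ : ∀ x ∈ Ω, 0 ≤ σ x) (f g : L2 Ω) : ⟪S f, S g⟫_ℝ = ∫ x in Ω, σ x * f x * g x := by
  rw [inner_eq_integral]
  refine integral_congr_ae ?_
  filter_upwards [hS f, hS g, ae_restrict_mem hΩ] with x h1 h2 hx
  rw [h1, h2]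
  linear_combination (f x * g x) * Real.mul_self_sqrt (hσ x hx)

theorem isMode_iff (hS : IsMulSqrt σ S) (hΩ : MeasurableSet Ω)
    (hσ : ∀ x ∈ Ω, 0 ≤ σ x) (V : BoundaryCondition Ω) (E : ℝ) (Ψ : L2 Ω) :
    IsMode V σ E Ψ ↔ IsFormMode V.dom S E Ψ := by
  simp only [IsMode, IsFormMode, hS.inner_apply_apply hΩ hσ, L2.inner_def]

theorem isNormalized_iff (hS : IsMulSqrt σ S) (hΩ : MeasurableSet Ω)
    (hσ : ∀ x ∈ Ω, 0 ≤ σ x) (Ψ : L2 Ω) : IsNormalized σ Ψ ↔ ⟪S Ψ, S Ψ⟫_ℝ = 1 := by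
  rw [hS.inner_apply_apply hΩ hσ, IsNormalized]
  simp only [sq, mul_assoc]

theorem overlap_eq (hS : IsMulSqrt σ S) {Ξ : Space d → ℝ} {x : L2 Ω} (h : Ξ =ᵐ[vol Ω] x)
    (Ψ : L2 Ω) : overlap σ Ξ Ψ = ⟪x, S Ψ⟫_ℝ := by
  rw [overlap, inner_eq_integral]
  refine integral_congr_ae ?_
  filter_upwards [h, hS Ψ] with y h1 h2
  rw [h1, h2]

end IsMulSqrt

theorem isMulSqrt_one : IsMulSqrt (fun _ => 1) (ContinuousLinearMap.id ℝ (L2 Ω)) := fun f => by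
  simp

theorem mem_dom_of_isMode_zero {V : BoundaryCondition Ω} {σ : Space d → ℝ} {Ψ : L2 Ω}
    (h : IsMode V σ 0 Ψ) : (Ψ, 0) ∈ V.dom := by
  obtain ⟨-, g, hg, hw⟩ := h
  have h0 : ⟪g, g⟫_ℝ = 0 := by
    rw [L2.inner_def, hw _ hg, zero_mul]
  rwa [inner_self_eq_zero.1 h0] at hg

/-- Solvability for every `f` forces the right-hand side to annihilate all zero-gradient elements of
the form domain. Finite measure of Ω and constancy of the zero modes both follow from this. -/
theorem IsRegularizedGreen.integral_eq_zero {V : BoundaryCondition Ω} {G : Space d → Space d → ℝ}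
    (hG : IsRegularizedGreen V G) {v : L2 Ω} (hv : (v, 0) ∈ V.dom) (f : L2 Ω) :
    ∫ x in Ω, (f x - ⨍ y in Ω, f y) * v x = 0 := by
  obtain ⟨-, u, -, -, -, hw⟩ := hG.2 f (Lp.memLp f)
  rw [← hw _ hv, ← L2.inner_def, inner_zero_right]

theorem IsRegularizedGreen.isFiniteMeasure {V : BoundaryCondition Ω} {G : Space d → Space d → ℝ}
    (hG : IsRegularizedGreen V G) {v : L2 Ω} (hv0 : v ≠ 0) (hv : (v, 0) ∈ V.dom) :
    IsFiniteMeasure (vol Ω) := by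
  by_contra hfin
  have htop : vol Ω Set.univ = ⊤ := by
    by_contra h
    exact hfin ⟨lt_top_iff_ne_top.2 h⟩
  have h := hG.integral_eq_zero hv v
  -- On a set of infinite measure the average is 0 by convention, so the choice `f = v` gives `‖v‖ =
  -- 0`.
  have havg : ⨍ y in Ω, v y = 0 := by
    rw [average_eq, measureReal_def, htop]; simp
  rw [havg] at h
  simp only [sub_zero] at h
  rw [← inner_eq_integral] at h
  exact hv0 (inner_self_eq_zero.1 h)

theorem IsRegularizedGreen.exists_isRegularizedInverse {V : BoundaryCondition Ω}
    {G : Space d → Space d → ℝ} (hG : IsRegularizedGreen V G) {v : L2 Ω} (hv0 : v ≠ 0)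
    (hv : (v, 0) ∈ V.dom) :
    ∃ (e : L2 Ω) (T : L2 Ω →L[ℝ] L2 Ω), (e =ᵐ[vol Ω] fun _ => 1) ∧
      IsRegularizedInverse V.dom e (T : L2 Ω →ₗ[ℝ] L2 Ω) ∧
      ∀ f : L2 Ω, T f =ᵐ[vol Ω] fun x => ∫ y in Ω, G x y * f y := by
  have hfin := hG.isFiniteMeasure hv0 hv
  set e : L2 Ω := Lp.const 2 (vol Ω) (1 : ℝ) with he
  have hee : e =ᵐ[vol Ω] fun _ => 1 := Lp.coeFn_const 2 (vol Ω) (1 : ℝ)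
  have hie : ∀ f : L2 Ω, ⟪e, f⟫_ℝ = ∫ x in Ω, f x := by
    intro f
    rw [inner_eq_integral]
    refine integral_congr_ae ?_
    filter_upwards [hee] with x hx
    rw [hx, one_mul]
  have hif : ∀ (f w : L2 Ω) (a : ℝ), ∫ x in Ω, (f x - a) * w x = ⟪f - a • e, w⟫_ℝ := by
    intro f w a
    rw [inner_eq_integral]
    refine integral_congr_ae ?_
    filter_upwards [hee, Lp.coeFn_sub f (a • e), Lp.coeFn_smul a e] with x h1 h2 h3
    rw [h2, Pi.sub_apply, h3, Pi.smul_apply, h1, smul_eq_mul, mul_one]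
  -- `u` minus its mean is orthogonal to `u` by the compatibility condition and to `e` by
  -- construction, hence to itself.
  have hconst : ∀ u : L2 Ω, (u, 0) ∈ V.dom → u = (⨍ y in Ω, u y) • e := by
    intro u hu
    have h1 := hG.integral_eq_zero hu u
    rw [hif] at h1
    have h2 : ⟪u - (⨍ y in Ω, u y) • e, e⟫_ℝ = 0 := by
      rw [inner_sub_left, real_inner_smul_left, real_inner_comm, hie, hie,
        integral_congr_ae hee, integral_const, smul_eq_mul, mul_one, mul_comm,
        ← smul_eq_mul, measure_smul_average, sub_self]
    rw [← sub_eq_zero, ← inner_self_eq_zero (𝕜 := ℝ)]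
    conv_lhs => rw [inner_sub_right, real_inner_smul_right]
    rw [h1, h2, mul_zero, sub_zero]
  have ha : (⨍ y in Ω, v y) ≠ 0 := fun h => hv0 (by rw [hconst v hv, h, zero_smul])
  have hemem : (e, (0 : L2Field Ω)) ∈ V.dom := by
    have h1 := V.dom.smul_mem (⨍ y in Ω, v y)⁻¹ hv
    have h2 : (⨍ y in Ω, v y)⁻¹ • v = e := by
      rw [inv_smul_eq_iff₀ ha]; exact hconst v hv
    rw [← h2]
    simpa using h1
  have he0 : e ≠ 0 := fun h => hv0 (by rw [hconst v hv, h, smul_zero])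
  have hGint : ∀ f : L2 Ω, ∀ᵐ x ∂(vol Ω), Integrable (fun y => G x y * f y) (vol Ω) :=
    fun f => (hG.2 f (Lp.memLp f)).1
  choose u hu hueq humean hweak using fun f : L2 Ω => (hG.2 f (Lp.memLp f)).2
  let T₀ : L2 Ω →ₗ[ℝ] L2 Ω :=
    { toFun := fun f => (u f).1
      map_add' := fun f g => by
        refine Lp.ext ?_
        filter_upwards [hueq (f + g), hueq f, hueq g, hGint f, hGint g,
          Lp.coeFn_add (u f).1 (u g).1] with x h1 h2 h3 h4 h5 h6
        rw [h1, h6, Pi.add_apply, h2, h3, ← integral_add h4 h5]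
        refine integral_congr_ae ?_
        filter_upwards [Lp.coeFn_add f g] with y hy
        rw [hy, Pi.add_apply, mul_add]
      map_smul' := fun c f => by
        refine Lp.ext ?_
        filter_upwards [hueq (c • f), hueq f, Lp.coeFn_smul c (u f).1] with x h1 h2 h3
        rw [h1, RingHom.id_apply, h3, Pi.smul_apply, h2, smul_eq_mul, ← integral_const_mul]
        refine integral_congr_ae ?_
        filter_upwards [Lp.coeFn_smul c f] with y hy
        rw [hy, Pi.smul_apply, smul_eq_mul]
        ring }
  have hT : IsRegularizedInverse V.dom e T₀ :=
    { ne_zero := he0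
      zeroMode_mem := hemem
      eq_smul := fun w hw => ⟨_, hconst w hw⟩
      inner_eq_zero := fun f => by rw [hie]; exact humean f
      weak := fun f => ⟨(u f).2, ⨍ y in Ω, f y, hu f, fun w hw => by
        rw [L2.inner_def, hweak f w hw, hif]⟩ }
  -- Boundedness again comes from symmetry, without any estimate on `G`.
  exact ⟨e, ⟨T₀, hT.isSymmetric.continuous⟩, hee, hT, hueq⟩

theorem IsRegularizedInverse.isCompactOperator {V : BoundaryCondition Ω}
    (hV : HasDiscreteSpectrum V) (hΩ : MeasurableSet Ω) {e : L2 Ω} {T : L2 Ω →L[ℝ] L2 Ω}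
    (hT : IsRegularizedInverse V.dom e (T : L2 Ω →ₗ[ℝ] L2 Ω)) : IsCompactOperator T := by
  obtain ⟨φ, ε, hε, hφ⟩ := hV
  exact isCompactOperator_of_hilbertBasis hT.isSymmetric φ (tendsto_inv_atTop_zero.comp hε)
    fun n => hT.apply_of_isFormMode_id
      ((isMulSqrt_one.isMode_iff hΩ (fun _ _ => zero_le_one) V _ _).1 (hφ n))

theorem greenStep_ae_eq {σ : Space d → ℝ} {S T : L2 Ω →L[ℝ] L2 Ω} (hS : IsMulSqrt σ S)
    {G : Space d → Space d → ℝ} (hTG : ∀ f : L2 Ω, T f =ᵐ[vol Ω] fun x => ∫ y in Ω, G x y * f y)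
    {Ξ : Space d → ℝ} {x : L2 Ω} (h : Ξ =ᵐ[vol Ω] x) :
    greenStep Ω σ G Ξ =ᵐ[vol Ω] S (T (S x)) := by
  filter_upwards [hS (T (S x)), hTG (S x)] with z h1 h2
  rw [h1, h2, greenStep]
  congr 1
  refine integral_congr_ae ?_
  filter_upwards [h, hS x] with y h3 h4
  rw [h4, h3]

theorem removeZeroMode_ae_eq (hΩ : MeasurableSet Ω) {σ : Space d → ℝ} (hσ : ∀ x ∈ Ω, 0 ≤ σ x)
    {S : L2 Ω →L[ℝ] L2 Ω} (hS : IsMulSqrt σ S) {e : L2 Ω} (he : e =ᵐ[vol Ω] fun _ => 1)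
    {Ξ : Space d → ℝ} {x : L2 Ω} (h : Ξ =ᵐ[vol Ω] x) :
    removeZeroMode Ω σ Ξ =ᵐ[vol Ω] projAway (S e) x := by
  have h1 : ∫ y in Ω, √(σ y) * Ξ y = ⟪S e, x⟫_ℝ := by
    rw [inner_eq_integral]
    refine integral_congr_ae ?_
    filter_upwards [h, hS e, he] with y h1 h2 h3
    rw [h1, h2, h3, mul_one]
  have h2 : ∫ y in Ω, σ y = ⟪S e, S e⟫_ℝ := by
    rw [hS.inner_apply_apply hΩ hσ]
    refine integral_congr_ae ?_
    filter_upwards [he] with y h3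
    rw [h3, mul_one, mul_one]
  rw [projAway_apply]
  filter_upwards [h, hS e, he, Lp.coeFn_sub x ((⟪S e, x⟫_ℝ / ⟪S e, S e⟫_ℝ) • S e),
    Lp.coeFn_smul (⟪S e, x⟫_ℝ / ⟪S e, S e⟫_ℝ) (S e)] with y h3 h4 h5 h6 h7
  rw [h6, Pi.sub_apply, h7, Pi.smul_apply, h4, h5, removeZeroMode, h1, h2, h3, smul_eq_mul]
  ring

/-- `z` are the iterates from index `k` on and `b p` is `z (p + 1)` divided by √σ. Normalization
cancels the factors `E ^ p`, so the limits of the rescaled sequences determine those of the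
normalized ones. -/
theorem convergesToMode_of_geometric (hΩ : MeasurableSet Ω) {σ : Space d → ℝ}
    (hσpos : ∀ x ∈ Ω, 0 < σ x) {S : L2 Ω →L[ℝ] L2 Ω} (hS : IsMulSqrt σ S)
    {Ξ : ℕ → Space d → ℝ} {z b : ℕ → L2 Ω} {Ψ : L2 Ω} {k : ℕ}
    (hz : ∀ p, Ξ (p + k) =ᵐ[vol Ω] z p) (hb : ∀ p, z (p + 1) = S (b p)) {E c r C : ℝ}
    (hE : 0 < E) (hc : 0 < c) (hΨ : ‖S Ψ‖ = 1) (hr0 : 0 ≤ r) (hr : r < 1)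
    (hzlim : ∀ p, ‖E ^ p • z p - c • S Ψ‖ ≤ C * r ^ p)
    (hblim : ∀ p, ‖E ^ (p + 1) • b p - c • Ψ‖ ≤ C * r ^ p) : ConvergesToMode σ Ξ Ψ := by
  have hgeo : Tendsto (fun p : ℕ => C * r ^ p) atTop (𝓝 0) := by
    simpa using (tendsto_pow_atTop_nhds_zero_of_lt_one hr0 hr).const_mul C
  have hz' : Tendsto (fun p => E ^ p • z p) atTop (𝓝 (c • S Ψ)) :=
    tendsto_iff_norm_sub_tendsto_zero.2 (squeeze_zero (fun _ => norm_nonneg _) hzlim hgeo)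
  have hb' : Tendsto (fun p => E ^ (p + 1) • b p) atTop (𝓝 (c • Ψ)) :=
    tendsto_iff_norm_sub_tendsto_zero.2 (squeeze_zero (fun _ => norm_nonneg _) hblim hgeo)
  have hn : Tendsto (fun p => ‖E ^ p • z p‖⁻¹) atTop (𝓝 c⁻¹) := by
    have h := hz'.norm
    rw [norm_smul, hΨ, mul_one, Real.norm_of_nonneg hc.le] at h
    exact h.inv₀ hc.ne'
  have hscale : ∀ p, ‖z p‖⁻¹ = ‖E ^ p • z p‖⁻¹ * E ^ p := by
    intro p
    have hEp : 0 < E ^ p := by positivity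
    rw [norm_smul, Real.norm_of_nonneg hEp.le, mul_inv, mul_comm, mul_inv_cancel_left₀ hEp.ne']
  have hzn : Tendsto (fun p => ‖z p‖⁻¹ • z p) atTop (𝓝 (S Ψ)) := by
    have h := hn.smul hz'
    rw [inv_smul_smul₀ hc.ne'] at h
    simpa only [hscale, mul_smul] using h
  have hbn : Tendsto (fun p => ‖z (p + 1)‖⁻¹ • b p) atTop (𝓝 Ψ) := by
    have h := (hn.comp (tendsto_add_atTop_nat 1)).smul hb'
    rw [inv_smul_smul₀ hc.ne'] at h
    simpa only [hscale, mul_smul, Function.comp_def] using h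
  have henorm : ∀ {f : ℕ → L2 Ω} {f' : L2 Ω}, Tendsto f atTop (𝓝 f') →
      Tendsto (fun p => eLpNorm (f p - f' : L2 Ω) 2 (vol Ω)) atTop (𝓝 0) := by
    intro f f' h
    have h1 := (continuous_enorm.tendsto (0 : L2 Ω)).comp (tendsto_sub_nhds_zero_iff.2 h)
    rw [enorm_zero] at h1
    simpa only [Function.comp_def, Lp.enorm_def] using h1
  -- The quotient is available only from `p + 1` on: `z 0` need not lie in the range of `S`.
  have hquot : ∀ p, ∀ᵐ x ∂(vol Ω), Ξ (p + 1 + k) x / norm2 Ω (Ξ (p + 1 + k)) / √(σ x)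
      = ‖z (p + 1)‖⁻¹ * b p x := by
    intro p
    filter_upwards [hz (p + 1), hS (b p), ae_restrict_mem hΩ] with x h1 h2 hx
    rw [norm2_eq_norm (hz (p + 1)), h1, hb p, h2]
    have := (Real.sqrt_pos.2 (hσpos x hx)).ne'
    field_simp
  refine ⟨?_, ?_, ?_⟩
  · rw [← tendsto_add_atTop_iff_nat k]
    refine (henorm hzn).congr fun p => eLpNorm_congr_ae ?_
    filter_upwards [hz p, hS Ψ, Lp.coeFn_sub (‖z p‖⁻¹ • z p) (S Ψ),
      Lp.coeFn_smul ‖z p‖⁻¹ (z p)] with x h1 h2 h3 h4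
    rw [h3, Pi.sub_apply, h4, h2, Pi.smul_apply, norm2_eq_norm (hz p), h1, smul_eq_mul,
      div_eq_inv_mul]
  · rw [← tendsto_add_atTop_iff_nat k, ← tendsto_add_atTop_iff_nat 1]
    refine (henorm hbn).congr fun p => eLpNorm_congr_ae ?_
    filter_upwards [hquot p, Lp.coeFn_sub (‖z (p + 1)‖⁻¹ • b p) Ψ,
      Lp.coeFn_smul ‖z (p + 1)‖⁻¹ (b p)] with x h1 h2 h3
    rw [h2, Pi.sub_apply, h3, Pi.smul_apply, h1, smul_eq_mul]
  · have hpt := ae_tendsto_of_norm_sub_le_geometric hr0 hr hblim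
    filter_upwards [hpt, ae_all_iff.2 hquot, Lp.coeFn_smul c Ψ,
      ae_all_iff.2 fun p => Lp.coeFn_smul (E ^ (p + 1)) (b p)] with x h1 h2 h3 h4
    rw [← tendsto_add_atTop_iff_nat k, ← tendsto_add_atTop_iff_nat 1]
    have h := (hn.comp (tendsto_add_atTop_nat 1)).mul h1
    rw [h3, Pi.smul_apply, smul_eq_mul, inv_mul_cancel_left₀ hc.ne'] at h
    refine h.congr fun p => ?_
    rw [h2, h4, hscale, Pi.smul_apply, smul_eq_mul, Function.comp_apply, mul_assoc]

end Concrete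

end Helmholtz

/-! ### The iterates as powers of the operator, and the theorem. -/

namespace Helmholtz

theorem iterates_succ_ae_eq {d : ℕ} {Ω : Set (Space d)} (hΩ : MeasurableSet Ω)
    {σ : Space d → ℝ} (hσ : ∀ x ∈ Ω, 0 ≤ σ x) {S T : L2 Ω →L[ℝ] L2 Ω} (hS : IsMulSqrt σ S)
    {e : L2 Ω} (he : e =ᵐ[vol Ω] fun _ => 1) {G : Space d → Space d → ℝ}
    (hTG : ∀ f : L2 Ω, T f =ᵐ[vol Ω] fun x => ∫ y in Ω, G x y * f y) {Ξ₀ : Space d → ℝ} {p : ℕ}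
    {x : L2 Ω} (h : iterates Ω σ G Ξ₀ p =ᵐ[vol Ω] x) :
    iterates Ω σ G Ξ₀ (p + 1) =ᵐ[vol Ω] S (liftedStep S T e x) := by
  rw [apply_liftedStep]
  exact removeZeroMode_ae_eq hΩ hσ hS he (greenStep_ae_eq hS hTG h)

theorem exists_iterates_ae_eq {d : ℕ} {Ω : Set (Space d)} (hΩ : MeasurableSet Ω)
    {σ : Space d → ℝ} (hσ : ∀ x ∈ Ω, 0 ≤ σ x) {S T : L2 Ω →L[ℝ] L2 Ω} (hS : IsMulSqrt σ S)
    {e : L2 Ω} (he : e =ᵐ[vol Ω] fun _ => 1) {G : Space d → Space d → ℝ}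
    (hTG : ∀ f : L2 Ω, T f =ᵐ[vol Ω] fun x => ∫ y in Ω, G x y * f y) {Ξ₀ : Space d → ℝ}
    (hΞ₀ : MemLp Ξ₀ 2 (vol Ω)) (p : ℕ) : ∃ x : L2 Ω, iterates Ω σ G Ξ₀ p =ᵐ[vol Ω] x := by
  induction p with
  | zero => exact ⟨hΞ₀.toLp Ξ₀, hΞ₀.coeFn_toLp.symm⟩
  | succ p ih =>
    obtain ⟨x, hx⟩ := ih
    exact ⟨_, iterates_succ_ae_eq hΩ hσ hS he hTG hx⟩

theorem iterates_add_ae_eq {d : ℕ} {Ω : Set (Space d)} (hΩ : MeasurableSet Ω)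
    {σ : Space d → ℝ} (hσ : ∀ x ∈ Ω, 0 ≤ σ x) {S T : L2 Ω →L[ℝ] L2 Ω} (hS : IsMulSqrt σ S)
    {e : L2 Ω} (he : e =ᵐ[vol Ω] fun _ => 1) (hSe : S e ≠ 0) {G : Space d → Space d → ℝ}
    (hTG : ∀ f : L2 Ω, T f =ᵐ[vol Ω] fun x => ∫ y in Ω, G x y * f y) {Ξ₀ : Space d → ℝ} {k : ℕ}
    {θ : L2 Ω} (h : iterates Ω σ G Ξ₀ k =ᵐ[vol Ω] θ) (hθ : ⟪S e, θ⟫_ℝ = 0) (p : ℕ) :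
    iterates Ω σ G Ξ₀ (p + k) =ᵐ[vol Ω] (projectedStep S T e ^ p) θ := by
  induction p with
  | zero => simpa using h
  | succ p ih =>
    rw [add_right_comm, pow_succ', mul_apply_eq_comp,
      projectedStep_of_inner_eq_zero (inner_projectedStep_pow hSe hθ p)]
    exact iterates_succ_ae_eq hΩ hσ hS he hTG ih

/-- If the lowest overlapping mode has the simple eigenvalue `E₁`, then it is `±Ψ₁`, with the sign
of the overlap. -/
theorem IsLowestOverlappingMode.eq_sign_smul {d : ℕ} {Ω : Set (Space d)}
    {V : BoundaryCondition Ω} {σ Θ : Space d → ℝ} {E E₁ : ℝ} {Ψ Ψ₁ : L2 Ω}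
    (h : IsLowestOverlappingMode V σ Θ E Ψ)
    (hE₁ : IsLeast {E : ℝ | 0 < E ∧ ∃ Ψ : L2 Ω, IsMode V σ E Ψ} E₁) (hΨ₁ : IsMode V σ E₁ Ψ₁)
    (hn : IsNormalized σ Ψ₁) (hsimple : ∀ Ψ : L2 Ω, IsMode V σ E₁ Ψ → ∃ a : ℝ, Ψ = a • Ψ₁)
    (hov : overlap σ Θ Ψ₁ ≠ 0) : Ψ = Real.sign (overlap σ Θ Ψ₁) • Ψ₁ := by
  obtain ⟨hleast, hmode, hnorm, c, hc, hproj⟩ := h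
  have hEE : E = E₁ := le_antisymm (hleast.2 ⟨hE₁.1.1, Ψ₁, hΨ₁, hov⟩)
    (hE₁.2 ⟨hleast.1.1, Ψ, hmode⟩)
  subst hEE
  obtain ⟨a, rfl⟩ := hsimple Ψ hmode
  have h1 : ∫ x in Ω, σ x * (a • Ψ₁ : L2 Ω) x ^ 2 = a ^ 2 := by
    rw [← mul_one (a ^ 2), ← show ∫ x in Ω, σ x * Ψ₁ x ^ 2 = 1 from hn, ← integral_const_mul]
    refine integral_congr_ae ?_
    filter_upwards [Lp.coeFn_smul a Ψ₁] with x hx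
    rw [hx, Pi.smul_apply, smul_eq_mul]
    ring
  have h2 : ∫ x in Ω, σ x * (a • Ψ₁ : L2 Ω) x * Ψ₁ x = a := by
    have hn' : a * ∫ x in Ω, σ x * Ψ₁ x ^ 2 = a := by
      rw [show ∫ x in Ω, σ x * Ψ₁ x ^ 2 = 1 from hn, mul_one]
    refine Eq.trans ?_ hn'
    rw [← integral_const_mul]
    refine integral_congr_ae ?_
    filter_upwards [Lp.coeFn_smul a Ψ₁] with x hx
    rw [hx, Pi.smul_apply, smul_eq_mul]
    ring
  have ha : a ^ 2 = 1 := h1.symm.trans hnorm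
  have hs : overlap σ Θ Ψ₁ = c * a := by rw [hproj Ψ₁ hΨ₁, h2]
  congr 1
  -- Normalization leaves `a = 1` or `a = -1`, and `c > 0` makes `a` the sign of the overlap.
  rw [hs]
  rcases (sq_eq_sq_iff_eq_or_eq_neg.1 (ha.trans (one_pow 2).symm)) with rfl | rfl
  · rw [Real.sign_of_pos (by linarith)]
  · rw [Real.sign_of_neg (by linarith)]

end Helmholtz

open Helmholtz
theorem theorem2 {d : ℕ} (Ω : Set (Space d)) (hΩ : IsOpen Ω) (hΩc : IsConnected Ω)
    (V : BoundaryCondition Ω) (hV : HasDiscreteSpectrum V)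
    (σ : Space d → ℝ) (hσm : Measurable σ) (hσpos : ∀ x ∈ Ω, 0 < σ x)
    (hσbdd : ∃ M : ℝ, ∀ x ∈ Ω, σ x ≤ M)
    (hzero : ∃ Ψ₀ : L2 Ω, IsMode V σ 0 Ψ₀)
    (G : Space d → Space d → ℝ) (hG : IsRegularizedGreen V G)
    (Ξ₀ : Space d → ℝ) (hΞ₀ : MeasureTheory.MemLp Ξ₀ 2 (vol Ω)) :
    (∀ p, MeasureTheory.MemLp (iterates Ω σ G Ξ₀ p) 2 (vol Ω)) ∧
    -- `Θ` is the ansatz itself if it has no component along `√σ`; for an arbitrary ansatz,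
    -- `Θ` is the first iterate
    ∀ Θ : Space d → ℝ,
      (Θ = Ξ₀ ∧ ∫ x in Ω, √(σ x) * Ξ₀ x = 0) ∨ Θ = iterates Ω σ G Ξ₀ 1 →
      -- convergence to the lowest positive mode having an overlap with `Θ`
      ((overlappingEigenvalues V σ Θ).Nonempty →
        ∃ (E : ℝ) (Ψ : L2 Ω), IsLowestOverlappingMode V σ Θ E Ψ ∧
          ConvergesToMode σ (iterates Ω σ G Ξ₀) Ψ) ∧
      -- in particular, convergence to the mode with the smallest positive eigenvalue
      (∀ (E₁ : ℝ) (Ψ₁ : L2 Ω),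
        IsLeast {E : ℝ | 0 < E ∧ ∃ Ψ : L2 Ω, IsMode V σ E Ψ} E₁ →
        IsMode V σ E₁ Ψ₁ → IsNormalized σ Ψ₁ →
        (∀ Ψ : L2 Ω, IsMode V σ E₁ Ψ → ∃ a : ℝ, Ψ = a • Ψ₁) →
        overlap σ Θ Ψ₁ ≠ 0 →
          ConvergesToMode σ (iterates Ω σ G Ξ₀) (Real.sign (overlap σ Θ Ψ₁) • Ψ₁)) := by
  have hΩm := hΩ.measurableSet
  have hσ : ∀ x ∈ Ω, 0 ≤ σ x := fun x hx => (hσpos x hx).le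
  obtain ⟨Ψ₀, hΨ₀⟩ := hzero
  obtain ⟨S, hS⟩ := exists_isMulSqrt hΩm hσm hσbdd
  obtain ⟨e, T, he, hT, hTG⟩ :=
    hG.exists_isRegularizedInverse hΨ₀.1 (mem_dom_of_isMode_zero hΨ₀)
  have hTc := hT.isCompactOperator hV hΩm
  have hSinj := hS.injective hΩm hσpos
  have hSe : S e ≠ 0 := fun h => hT.ne_zero (hSinj (by rw [h, map_zero]))
  have hex := exists_iterates_ae_eq hΩm hσ hS he hTG hΞ₀
  refine ⟨fun p => ?_, fun Θ hΘ => ?_⟩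
  · obtain ⟨x, hx⟩ := hex p
    exact (memLp_congr_ae hx).2 (Lp.memLp x)
  -- The two choices of `Θ` differ only in the index `k`, 0 or 1, from which the iterates are known
  -- to be orthogonal to √σ.
  obtain ⟨k, θ, hk, hkθ, hθ⟩ : ∃ (k : ℕ) (θ : L2 Ω), Θ = iterates Ω σ G Ξ₀ k ∧
      iterates Ω σ G Ξ₀ k =ᵐ[vol Ω] θ ∧ ⟪S e, θ⟫_ℝ = 0 := by
    obtain ⟨x, hx⟩ := hex 0
    rcases hΘ with ⟨h, h0⟩ | h
    · refine ⟨0, x, h, hx, ?_⟩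
      rw [inner_eq_integral, ← h0]
      refine integral_congr_ae ?_
      filter_upwards [hx, hS e, he] with y h1 h2 h3
      rw [h2, h3, mul_one, ← h1, iterates]
    · refine ⟨1, _, h, iterates_succ_ae_eq hΩm hσ hS he hTG hx, ?_⟩
      rw [apply_liftedStep]
      exact inner_projAway hSe _
  have hov : ∀ Ψ, overlap σ Θ Ψ = ⟪θ, S Ψ⟫_ℝ := fun Ψ => hS.overlap_eq (hk ▸ hkθ) Ψ
  have hmode := hS.isMode_iff hΩm hσ V
  have main : (overlappingEigenvalues V σ Θ).Nonempty →
      ∃ (E : ℝ) (Ψ : L2 Ω), IsLowestOverlappingMode V σ Θ E Ψ ∧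
        ConvergesToMode σ (iterates Ω σ G Ξ₀) Ψ := by
    rintro ⟨E', hE', Ψ', hΨ', hne⟩
    rw [hov] at hne
    obtain ⟨E, Ψ, c, hE, hc, hΨ, hn, hproj, hleast, r, C, hr0, hr, hz, hb⟩ :=
      exists_lowest_formMode hT hTc hS.isSymmetric hSinj
        ⟨E', Ψ', hE', (hmode _ _).1 hΨ', hne⟩
    refine ⟨E, Ψ, ⟨⟨⟨hE, Ψ, (hmode _ _).2 hΨ, ?_⟩, ?_⟩, (hmode _ _).2 hΨ,
      (hS.isNormalized_iff hΩm hσ Ψ).2 hn, c, hc, fun χ hχ => ?_⟩, ?_⟩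
    · rw [hov, hproj Ψ hΨ, hn, mul_one]
      exact hc.ne'
    · rintro E'' ⟨hE'', χ, hχ, hχne⟩
      rw [hov] at hχne
      exact hleast E'' χ hE'' ((hmode _ _).1 hχ) hχne
    · rw [hov, hproj χ ((hmode _ _).1 hχ), hS.inner_apply_apply hΩm hσ]
    · refine convergesToMode_of_geometric hΩm hσpos hS
        (iterates_add_ae_eq hΩm hσ hS he hSe hTG hkθ hθ) (fun p => ?_) hE hc ?_ hr0 hr hz hb
      · rw [pow_succ', mul_apply_eq_comp,
          projectedStep_of_inner_eq_zero (inner_projectedStep_pow hSe hθ p)]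
      · rw [real_inner_self_eq_norm_sq] at hn
        exact (pow_eq_one_iff_of_nonneg (norm_nonneg _) two_ne_zero).1 hn
  refine ⟨main, fun E₁ Ψ₁ hE₁ hΨ₁ hn hsimple hne => ?_⟩
  obtain ⟨E, Ψ, hlow, hconv⟩ := main ⟨E₁, hE₁.1.1, Ψ₁, hΨ₁, hne⟩
  rwa [← hlow.eq_sign_smul hE₁ hΨ₁ hn hsimple hne]
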